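/- **Setting.** Let $\hat A_i^{(k)}$ ($i\in\mathbb N$, $1\le k\le K$) and $A_j$ ($j\in\mathbb N$) be random elements of $\mathbb R^{T\times d}$ on a probability space (generated candidate action sequences and ground-truth target sequences). For real weights $w_1,\dots,w_d$ and a real constant $\varepsilon_c$ put $$D_{i,k\to j}=\frac1T\sum_{t=1}^{T}\sum_{l=1}^{d} w_l\sqrt{\big(\hat A^{(k)}_{i,t,l}-A_{j,t,l}\big)^2+\varepsilon_c^2}.$$ Let $D_1,D_2,\dots$ be a sequence of such distances, $D_n=D_{i_n,k_n\to j_n}$, and assume that the $D_n$ are independent and identically distributed with distribution function $F$. Let $$F_N(x)=\frac1N\,\#\{n\le N: D_n\le x\},\qquad Q(q)=F^{-1}(q)=\inf\{x: F(x)\ge q\},\qquad \hat Q_N(q)=\inf\{x: F_N(x)\ge q\}$$ be the empirical distribution function of the first $N$ distances, the true $q$-quantile and the empirical $q$-quantile. **Lemma (Consistency of the batch-global quantile estimator).** (i) $\sup_{x\in\mathbb R}|F_N(x)-F(x)|\to0$ almost surely as $N\to\infty$. Now let $0<q<1$, put $\xi=F^{-1}(q)$, and suppose that $F$ is differentiable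 at $\xi$ with $f(\xi):=F'(\xi)>0$ (the density at $\xi$). (ii) If $\mathbb E|D_1|^{\delta}<\infty$ for some $\delta>0$, then $\hat Q_N(q)$ has a finite second moment for all sufficiently large $N$, and $$\operatorname{Var}\big(\hat Q_N(q)\big)=\frac{q(1-q)}{N f(\xi)^2}+o(1/N)\qquad(N\to\infty).$$ (iii) $\hat Q_N(q)\to Q(q)$ in probability as $N\to\infty$; and, if $\mathbb E|D_1|^{\delta}<\infty$ for some $\delta>0$, then $\operatorname{Var}(\hat Q_N(q))=O(1/N)$. -/

import Mathlib

open MeasureTheory ProbabilityTheory Filter Topology Asymptotics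

noncomputable section

/-- The robust (Charbonnier) sequence distance between a predicted and a target action sequence
of horizon `T` and action dimension `d`, with weights `w` and smoothing constant `εc`. -/
def charbonnierDist {T d : ℕ} (w : Fin d → ℝ) (εc : ℝ) (Ahat A : Fin T → Fin d → ℝ) : ℝ :=
  (1 / (T : ℝ)) * ∑ t, ∑ l, w l * Real.sqrt ((Ahat t l - A t l) ^ 2 + εc ^ 2)

/-- The batch-global distance from the `k`-th candidate of item `i` to the target of item `j`,
as a random variable; the argument is the triple `(i, k, j)`. -/
def batchDist {Ω : Type*} {T d K : ℕ} (w : Fin d → ℝ) (εc : ℝ)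
    (cand : ℕ → Fin K → Ω → Fin T → Fin d → ℝ) (target : ℕ → Ω → Fin T → Fin d → ℝ)
    (s : ℕ × Fin K × ℕ) (ω : Ω) : ℝ :=
  charbonnierDist w εc (cand s.1 s.2.1 ω) (target s.2.2 ω)

/-- The empirical CDF of the first `N` terms of a real sequence. -/
def empiricalCDF (x : ℕ → ℝ) (N : ℕ) (t : ℝ) : ℝ :=
  (((Finset.range N).filter (fun n => x n ≤ t)).card : ℝ) / (N : ℝ)

/-- The generalized inverse `F⁻¹(q) = inf {t | q ≤ F t}` of a distribution function. -/
def quantileOf (F : ℝ → ℝ) (q : ℝ) : ℝ :=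
  sInf {t : ℝ | q ≤ F t}

/-- The empirical `q`-quantile of the first `N` terms of a real sequence. -/
def empiricalQuantile (x : ℕ → ℝ) (N : ℕ) (q : ℝ) : ℝ :=
  quantileOf (empiricalCDF x N) q

end

/-! Everything reduces to hit counts, which are sums of i.i.d. Bernoulli variables. The bridge is
the Galois connection `empiricalQuantile_le_iff`: the empirical quantile is at most `t` exactly when
at least `N * q` sample points are.

Uniform convergence follows from the strong law on the countably many open and closed half-lines
ending at rational quantiles, since monotonicity interpolates between finitely many levels.

For the variance, let `Z_N` be the empirical deficit at `ξ`, whose variance is exactly `q * (1 -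
q)`. Differentiability at the single point `ξ` suffices for `f * √N * (quantile - ξ) - Z_N` to tend
to 0 in probability (`tendsto_bahadur_remainder`). Convergence of variances needs L², so this is
combined with tails `C / t ^ 4` uniform in `N` (`exists_scaled_empiricalQuantile_tail`). Near `ξ`
they come from Hoeffding and linear growth of `F`. Far away, an extreme quantile forces a positive
fraction of the sample to be extreme, and Chernoff raises the power tail of one observation to a
power proportional to `N`, so any `δ > 0` is enough. Layer cake and dominated convergence then give
L² convergence, and Cauchy–Schwarz transfers the variance. Both variance claims follow from the
limit of `N * Var`; consistency needs only the Hoeffding bound. -/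

/-- The number of the first `N` terms of `x` that lie in `B`, as a real number. -/
noncomputable def hitCount (x : ℕ → ℝ) (B : Set ℝ) (N : ℕ) : ℝ :=
  ∑ i ∈ Finset.range N, B.indicator (fun _ => (1 : ℝ)) (x i)

/-! ### Hit counts: moments, strong law, Hoeffding and Chernoff bounds. -/

section Hits

variable {Ω : Type*} [MeasurableSpace Ω] {P : Measure Ω}
  {D : ℕ → Ω → ℝ} {B : Set ℝ}

lemma measurable_indicator_one (hB : MeasurableSet B) :
    Measurable (B.indicator (fun _ => (1 : ℝ))) :=
  measurable_const.indicator hB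

lemma measurable_hitCount (hm : ∀ n, Measurable (D n)) (hB : MeasurableSet B) (N : ℕ) :
    Measurable fun ω => hitCount (fun n => D n ω) B N :=
  Finset.measurable_sum _ fun i _ => (measurable_indicator_one hB).comp (hm i)

lemma hitCount_nonneg (x : ℕ → ℝ) (B : Set ℝ) (N : ℕ) : 0 ≤ hitCount x B N :=
  Finset.sum_nonneg fun _ _ => Set.indicator_nonneg (fun _ _ => zero_le_one) _

lemma hitCount_mono (x : ℕ → ℝ) {B C : Set ℝ} (h : B ⊆ C) (N : ℕ) :
    hitCount x B N ≤ hitCount x C N :=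
  Finset.sum_le_sum fun _ _ => Set.indicator_le_indicator_of_subset h (fun _ => zero_le_one) _

lemma hitCount_compl (x : ℕ → ℝ) (B : Set ℝ) (N : ℕ) :
    hitCount x Bᶜ N = N - hitCount x B N := by
  rw [eq_sub_iff_add_eq, hitCount, hitCount, ← Finset.sum_add_distrib]
  have : ∀ a : ℝ, Bᶜ.indicator (fun _ => (1 : ℝ)) a + B.indicator (fun _ => (1 : ℝ)) a = 1 := by
    intro a
    exact congrFun (Set.indicator_compl_add_self B fun _ => (1 : ℝ)) a
  simp [this]

lemma iIndepFun_indicator (hi : iIndepFun D P) (hB : MeasurableSet B) :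
    iIndepFun (fun n ω => B.indicator (fun _ => (1 : ℝ)) (D n ω)) P :=
  hi.comp (fun _ => B.indicator fun _ => (1 : ℝ)) fun _ => measurable_indicator_one hB

lemma identDistrib_indicator (hd : ∀ n, IdentDistrib (D n) (D 0) P P) (hB : MeasurableSet B)
    (n : ℕ) : IdentDistrib (fun ω => B.indicator (fun _ => (1 : ℝ)) (D n ω))
      (fun ω => B.indicator (fun _ => (1 : ℝ)) (D 0 ω)) P P :=
  (hd n).comp (measurable_indicator_one hB)

lemma integral_indicator_comp (hm : Measurable (D 0)) (hB : MeasurableSet B) :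
    ∫ ω, B.indicator (fun _ => (1 : ℝ)) (D 0 ω) ∂P = P.real (D 0 ⁻¹' B) := by
  have : (fun ω => B.indicator (fun _ => (1 : ℝ)) (D 0 ω))
      = (D 0 ⁻¹' B).indicator fun _ => (1 : ℝ) := by
    ext ω; rfl
  rw [this, integral_indicator_const _ (hm hB)]
  simp

lemma integral_indicator_comp_n (hm : ∀ n, Measurable (D n))
    (hd : ∀ n, IdentDistrib (D n) (D 0) P P) (hB : MeasurableSet B) (n : ℕ) :
    ∫ ω, B.indicator (fun _ => (1 : ℝ)) (D n ω) ∂P = P.real (D 0 ⁻¹' B) := by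
  rw [(identDistrib_indicator hd hB n).integral_eq, integral_indicator_comp (hm 0) hB]

variable [IsProbabilityMeasure P]

lemma indicator_mem_Icc (B : Set ℝ) (a : ℝ) :
    B.indicator (fun _ => (1 : ℝ)) a ∈ Set.Icc (0 : ℝ) 1 := by
  by_cases h : a ∈ B <;> simp [h]

lemma memLp_indicator_comp (hm : ∀ n, Measurable (D n)) (hB : MeasurableSet B) (n : ℕ)
    (p : ENNReal) : MemLp (fun ω => B.indicator (fun _ => (1 : ℝ)) (D n ω)) p P := by
  refine MemLp.of_bound ((measurable_indicator_one hB).comp (hm n)).aestronglyMeasurable 1 ?_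
  refine ae_of_all _ fun ω => ?_
  have := indicator_mem_Icc B (D n ω)
  rw [Real.norm_eq_abs, abs_le]
  constructor <;> linarith [this.1, this.2]

lemma memLp_hitCount (hm : ∀ n, Measurable (D n)) (hB : MeasurableSet B) (N : ℕ)
    (p : ENNReal) : MemLp (fun ω => hitCount (fun n => D n ω) B N) p P :=
  memLp_finsetSum _ fun i _ => memLp_indicator_comp hm hB i p

lemma integral_hitCount (hm : ∀ n, Measurable (D n))
    (hd : ∀ n, IdentDistrib (D n) (D 0) P P) (hB : MeasurableSet B) (N : ℕ) :
    ∫ ω, hitCount (fun n => D n ω) B N ∂P = N * P.real (D 0 ⁻¹' B) := by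
  unfold hitCount
  rw [integral_finsetSum _ fun i _ => memLp_one_iff_integrable.1 (memLp_indicator_comp hm hB i 1)]
  simp [integral_indicator_comp_n hm hd hB]

lemma ae_tendsto_hitCount_div (hm : ∀ n, Measurable (D n)) (hi : iIndepFun D P)
    (hd : ∀ n, IdentDistrib (D n) (D 0) P P) (hB : MeasurableSet B) :
    ∀ᵐ ω ∂P, Tendsto (fun N : ℕ => hitCount (fun n => D n ω) B N / N) atTop
      (𝓝 (P.real (D 0 ⁻¹' B))) := by
  rw [← integral_indicator_comp (hm 0) hB]
  exact strong_law_ae_real (fun n ω => B.indicator (fun _ => (1 : ℝ)) (D n ω))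
    (memLp_one_iff_integrable.1 (memLp_indicator_comp hm hB 0 1))
    (fun i j hij => (iIndepFun_indicator hi hB).indepFun hij) (identDistrib_indicator hd hB)

lemma variance_hitCount (hm : ∀ n, Measurable (D n)) (hi : iIndepFun D P)
    (hd : ∀ n, IdentDistrib (D n) (D 0) P P) (hB : MeasurableSet B) (N : ℕ) :
    variance (fun ω => hitCount (fun n => D n ω) B N) P
      = N * (P.real (D 0 ⁻¹' B) * (1 - P.real (D 0 ⁻¹' B))) := by
  have h := IndepFun.variance_sum (μ := P) (s := Finset.range N)
    (X := fun n ω => B.indicator (fun _ => (1 : ℝ)) (D n ω))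
    (fun i _ => memLp_indicator_comp hm hB i 2)
    (fun i _ j _ hij => (iIndepFun_indicator hi hB).indepFun hij)
  have e : (fun ω => hitCount (fun n => D n ω) B N)
      = ∑ i ∈ Finset.range N, fun ω => B.indicator (fun _ => (1 : ℝ)) (D i ω) := by
    ext ω; simp [hitCount]
  rw [e, h]
  have hv : ∀ i, variance (fun ω => B.indicator (fun _ => (1 : ℝ)) (D i ω)) P
      = P.real (D 0 ⁻¹' B) * (1 - P.real (D 0 ⁻¹' B)) := by
    intro i
    rw [variance_eq_sub (memLp_indicator_comp hm hB i 2)]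
    have : (fun ω => B.indicator (fun _ => (1 : ℝ)) (D i ω)) ^ 2
        = fun ω => B.indicator (fun _ => (1 : ℝ)) (D i ω) := by
      ext ω
      by_cases h : D i ω ∈ B <;> simp [h]
    rw [this, integral_indicator_comp_n hm hd hB]
    ring
  simp [hv]

/-- Hoeffding's inequality for hit counts, upper tail. -/
lemma hitCount_upper_tail (hm : ∀ n, Measurable (D n)) (hi : iIndepFun D P)
    (hd : ∀ n, IdentDistrib (D n) (D 0) P P) (hB : MeasurableSet B) (N : ℕ) {ε : ℝ}
    (hε : 0 ≤ ε) :
    P.real {ω | N * (P.real (D 0 ⁻¹' B) + ε) ≤ hitCount (fun n => D n ω) B N}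
      ≤ Real.exp (-2 * N * ε ^ 2) := by
  set p := P.real (D 0 ⁻¹' B)
  have hsub : ∀ i < N, HasSubgaussianMGF
      (fun ω => B.indicator (fun _ => (1 : ℝ)) (D i ω) - p) ((‖(1 : ℝ) - 0‖₊ / 2) ^ 2) P := by
    intro i _
    have := hasSubgaussianMGF_of_mem_Icc (μ := P)
      (X := fun ω => B.indicator (fun _ => (1 : ℝ)) (D i ω)) (a := 0) (b := 1)
      ((measurable_indicator_one hB).comp (hm i)).aemeasurable
      (ae_of_all _ fun ω => indicator_mem_Icc B (D i ω))
    rwa [integral_indicator_comp_n hm hd hB] at this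
  have hind : iIndepFun (fun i ω => B.indicator (fun _ => (1 : ℝ)) (D i ω) - p) P :=
    (iIndepFun_indicator hi hB).comp (fun _ x => x - p) fun _ => measurable_id.sub_const p
  have h := HasSubgaussianMGF.measure_sum_range_ge_le_of_iIndepFun hind hsub
    (ε := N * ε) (by positivity)
  have e : {ω | N * (p + ε) ≤ hitCount (fun n => D n ω) B N}
      = {ω | N * ε ≤ ∑ i ∈ Finset.range N, (B.indicator (fun _ => (1 : ℝ)) (D i ω) - p)} := by
    ext ω
    simp only [Set.mem_ofPred_eq, hitCount, Finset.sum_sub_distrib, Finset.sum_const,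
      Finset.card_range, nsmul_eq_mul]
    constructor <;> intro h <;> linarith
  rw [e]
  refine h.trans (le_of_eq ?_)
  congr 1
  rcases Nat.eq_zero_or_pos N with rfl | hN
  · simp
  · have : (0 : ℝ) < N := by exact_mod_cast hN
    simp only [sub_zero, nnnorm_one, NNReal.coe_pow, NNReal.coe_div, NNReal.coe_one,
      NNReal.coe_ofNat]
    field_simp

/-- Hoeffding's inequality for hit counts, lower tail. -/
lemma hitCount_lower_tail (hm : ∀ n, Measurable (D n)) (hi : iIndepFun D P)
    (hd : ∀ n, IdentDistrib (D n) (D 0) P P) (hB : MeasurableSet B) (N : ℕ) {ε : ℝ}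
    (hε : 0 ≤ ε) :
    P.real {ω | hitCount (fun n => D n ω) B N ≤ N * (P.real (D 0 ⁻¹' B) - ε)}
      ≤ Real.exp (-2 * N * ε ^ 2) := by
  refine le_trans (le_of_eq ?_) (hitCount_upper_tail hm hi hd hB.compl N hε)
  congr 1
  ext ω
  rw [Set.mem_ofPred_eq, Set.mem_ofPred_eq, hitCount_compl, Set.preimage_compl,
    probReal_compl_eq_one_sub (hm 0 hB)]
  constructor <;> intro h <;> linarith

/-- Chernoff's inequality for hit counts of a set of small probability. -/
lemma hitCount_chernoff (hm : ∀ n, Measurable (D n)) (hi : iIndepFun D P)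
    (hd : ∀ n, IdentDistrib (D n) (D 0) P P) (hB : MeasurableSet B) (N : ℕ) {a r : ℝ}
    (ha : 0 < a) (ha1 : a ≤ 1) (hp : P.real (D 0 ⁻¹' B) ≤ a) :
    P.real {ω | r * N ≤ hitCount (fun n => D n ω) B N} ≤ (2 * a ^ r) ^ N := by
  -- With `exp t = 1 / a`, each indicator has moment generating function `1 + (1 / a - 1) * p ≤ 2`,
  -- as `p ≤ a`.
  set t := -Real.log a with ht
  have ht0 : 0 ≤ t := by have := Real.log_nonpos ha.le ha1; linarith
  have hexp : Real.exp t = a⁻¹ := by rw [ht, Real.exp_neg, Real.exp_log ha]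
  have hmgf : ∀ i, mgf (fun ω => B.indicator (fun _ => (1 : ℝ)) (D i ω)) P t ≤ 2 := by
    intro i
    have e : (fun ω => Real.exp (t * B.indicator (fun _ => (1 : ℝ)) (D i ω)))
        = fun ω => 1 + (a⁻¹ - 1) * B.indicator (fun _ => (1 : ℝ)) (D i ω) := by
      ext ω
      by_cases h : D i ω ∈ B <;> simp [h, hexp]
    rw [mgf, e, integral_add (integrable_const _)
      ((memLp_one_iff_integrable.1 (memLp_indicator_comp hm hB i 1)).const_mul _),
      integral_const_mul, integral_indicator_comp_n hm hd hB]
    have h1 : a⁻¹ * P.real (D 0 ⁻¹' B) ≤ 1 := by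
      rw [inv_mul_le_iff₀ ha]; linarith
    have h2 : 0 ≤ P.real (D 0 ⁻¹' B) := measureReal_nonneg
    simp only [integral_const, probReal_univ, smul_eq_mul]
    linarith
  have e : (fun ω => hitCount (fun n => D n ω) B N)
      = ∑ i ∈ Finset.range N, fun ω => B.indicator (fun _ => (1 : ℝ)) (D i ω) := by
    ext ω; simp [hitCount]
  have hint : Integrable (fun ω => Real.exp (t * hitCount (fun n => D n ω) B N)) P := by
    refine Integrable.of_bound (C := Real.exp (t * N))
      (((measurable_hitCount hm hB N).const_mul t).exp).aestronglyMeasurable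
      (ae_of_all _ fun ω => ?_)
    rw [Real.norm_eq_abs, abs_of_pos (Real.exp_pos _)]
    have h1 := hitCount_compl (fun n => D n ω) B N
    have h2 := hitCount_nonneg (fun n => D n ω) Bᶜ N
    gcongr
    linarith
  refine (measure_ge_le_exp_mul_mgf (r * N) ht0 hint).trans ?_
  rw [e, (iIndepFun_indicator hi hB).mgf_sum fun i => (measurable_indicator_one hB).comp (hm i)]
  have hprod : ∏ i ∈ Finset.range N, mgf (fun ω => B.indicator (fun _ => (1 : ℝ)) (D i ω)) P t
      ≤ 2 ^ N := by
    refine (Finset.prod_le_prod (fun i _ => mgf_nonneg) fun i _ => hmgf i).trans ?_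
    simp
  have he : Real.exp (-t * (r * N)) = (a ^ r) ^ N := by
    rw [← Real.rpow_natCast, ← Real.rpow_mul ha.le, Real.rpow_def_of_pos ha, ht]
    congr 1; ring
  rw [he, mul_pow, mul_comm]
  gcongr

end Hits

/-! ### Quantiles as generalized inverses. -/

section Quantile

/-- The generalized inverse of a right-continuous monotone function is a lower adjoint. -/
lemma quantileOf_le_iff {F : ℝ → ℝ} {q x : ℝ} (hmono : Monotone F)
    (hrc : ∀ t, ContinuousWithinAt F (Set.Ici t) t) (hbot : ∃ a, F a < q) (htop : ∃ b, q ≤ F b) :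
    quantileOf F q ≤ x ↔ q ≤ F x := by
  obtain ⟨a, ha⟩ := hbot
  have hbdd : BddBelow {t | q ≤ F t} :=
    ⟨a, fun t ht => not_lt.1 fun h => (ht.trans (hmono h.le)).not_gt ha⟩
  refine ⟨fun h => le_trans ?_ (hmono h), fun h => csInf_le hbdd h⟩
  by_contra! hlt
  -- Right continuity keeps `F < q` on an interval to the right of the infimum, yet the infimum is
  -- approached from there by points with `q ≤ F`.
  obtain ⟨u, hu, hIco⟩ := mem_nhdsGE_iff_exists_Ico_subset.1 ((hrc _).eventually_lt_const hlt)
  obtain ⟨t, ht, htu⟩ := exists_lt_of_csInf_lt htop (show sInf {t | q ≤ F t} < u from hu)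
  have h1 : F t < q := hIco ⟨csInf_le hbdd ht, htu⟩
  exact absurd ht h1.not_ge

lemma quantileOf_cdf_le_iff {μ : Measure ℝ} {q x : ℝ} (hq : q ∈ Set.Ioo (0 : ℝ) 1) :
    quantileOf (cdf μ) q ≤ x ↔ q ≤ cdf μ x :=
  quantileOf_le_iff (monotone_cdf μ) (fun t => (cdf μ).right_continuous t)
    ((tendsto_cdf_atBot μ).eventually_lt_const hq.1).exists
    ((tendsto_cdf_atTop μ).eventually_const_le hq.2).exists

lemma empiricalCDF_eq_hitCount (x : ℕ → ℝ) (N : ℕ) (t : ℝ) :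
    empiricalCDF x N t = hitCount x (Set.Iic t) N / N := by
  simp [empiricalCDF, hitCount, Set.indicator_apply, Finset.sum_boole]

lemma monotone_empiricalCDF (x : ℕ → ℝ) (N : ℕ) : Monotone (empiricalCDF x N) := by
  intro s t hst
  rw [empiricalCDF_eq_hitCount, empiricalCDF_eq_hitCount]
  gcongr
  exact hitCount_mono x (Set.Iic_subset_Iic.2 hst) N

lemma empiricalCDF_nonneg (x : ℕ → ℝ) (N : ℕ) (t : ℝ) : 0 ≤ empiricalCDF x N t := by
  unfold empiricalCDF; positivity

lemma hitCount_div_le_one (x : ℕ → ℝ) (B : Set ℝ) (N : ℕ) : hitCount x B N / N ≤ 1 := by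
  refine div_le_one_of_le₀ ?_ (Nat.cast_nonneg N)
  have := hitCount_nonneg x Bᶜ N
  rw [hitCount_compl] at this
  linarith

lemma empiricalCDF_le_one (x : ℕ → ℝ) (N : ℕ) (t : ℝ) : empiricalCDF x N t ≤ 1 := by
  rw [empiricalCDF_eq_hitCount]
  exact hitCount_div_le_one x _ N

lemma continuousWithinAt_empiricalCDF (x : ℕ → ℝ) (N : ℕ) (t : ℝ) :
    ContinuousWithinAt (empiricalCDF x N) (Set.Ici t) t := by
  have e : empiricalCDF x N = fun t => hitCount x (Set.Iic t) N / N :=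
    funext fun t => empiricalCDF_eq_hitCount x N t
  rw [e]
  refine ContinuousWithinAt.div_const (tendsto_finsetSum _ fun i _ => ?_) _
  refine tendsto_nhds_of_eventually_eq ?_
  by_cases h : x i ≤ t
  · filter_upwards [self_mem_nhdsWithin] with s hs
    simp [h, h.trans hs]
  · filter_upwards [mem_nhdsWithin_of_mem_nhds (Iio_mem_nhds (not_le.1 h))] with s hs
    simp [h, not_le.2 (Set.mem_Iio.1 hs)]

/-- Turns events about the quantile into binomial events. Positivity of `N` matters: for `N = 0` the
empirical distribution function is identically 0 and never reaches `q`. -/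
lemma empiricalQuantile_le_iff (x : ℕ → ℝ) {N : ℕ} (hN : 0 < N) {q t : ℝ}
    (hq : q ∈ Set.Ioo (0 : ℝ) 1) :
    empiricalQuantile x N q ≤ t ↔ N * q ≤ hitCount x (Set.Iic t) N := by
  have hN' : (0 : ℝ) < N := by exact_mod_cast hN
  rw [empiricalQuantile, quantileOf_le_iff (monotone_empiricalCDF x N)
    (continuousWithinAt_empiricalCDF x N), empiricalCDF_eq_hitCount, le_div_iff₀ hN', mul_comm]
  · obtain ⟨a, ha⟩ := ((Finset.range N).image x).finite_toSet.bddBelow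
    refine ⟨a - 1, lt_of_eq_of_lt ?_ hq.1⟩
    rw [empiricalCDF, Finset.card_eq_zero.2, Nat.cast_zero, zero_div]
    refine Finset.filter_eq_empty_iff.2 fun i hi h => ?_
    have := ha (Finset.mem_coe.2 (Finset.mem_image_of_mem x hi))
    linarith
  · obtain ⟨b, hb⟩ := ((Finset.range N).image x).finite_toSet.bddAbove
    refine ⟨b, hq.2.le.trans (le_of_eq ?_)⟩
    rw [empiricalCDF, Finset.filter_true_of_mem, Finset.card_range, div_self hN'.ne']
    intro i hi
    exact hb (Finset.mem_coe.2 (Finset.mem_image_of_mem x hi))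

end Quantile

/-! ### Uniform convergence of the empirical distribution function. -/

section GlivenkoCantelli

variable {Ω : Type*} [MeasurableSpace Ω] {P : Measure Ω} [IsProbabilityMeasure P]
  {D : ℕ → Ω → ℝ}

lemma cdf_map_eq {X : Ω → ℝ} (hX : Measurable X) (t : ℝ) :
    cdf (P.map X) t = P.real (X ⁻¹' Set.Iic t) := by
  have := Measure.isProbabilityMeasure_map (μ := P) hX.aemeasurable
  rw [cdf_eq_real, map_measureReal_apply hX measurableSet_Iic]

lemma measurable_empiricalQuantile (hm : ∀ n, Measurable (D n)) {N : ℕ} (hN : 0 < N) {q : ℝ}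
    (hq : q ∈ Set.Ioo (0 : ℝ) 1) :
    Measurable fun ω => empiricalQuantile (fun n => D n ω) N q := by
  refine measurable_of_Iic fun t => ?_
  have : (fun ω => empiricalQuantile (fun n => D n ω) N q) ⁻¹' Set.Iic t
      = {ω | N * q ≤ hitCount (fun n => D n ω) (Set.Iic t) N} := by
    ext ω
    exact empiricalQuantile_le_iff _ hN hq
  rw [this]
  exact measurableSet_le measurable_const (measurable_hitCount hm measurableSet_Iic N)

/-- The mass of the open half-line is a left limit of the distribution function, which stays below
`q` to the left of the quantile. This controls a possible atom at a grid point. -/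
lemma measureReal_Iio_quantileOf_cdf_le {μ : Measure ℝ} [IsProbabilityMeasure μ] {q : ℝ}
    (hq : q ∈ Set.Ioo (0 : ℝ) 1) : μ.real (Set.Iio (quantileOf (cdf μ) q)) ≤ q := by
  have h := (cdf μ).measure_Iio (tendsto_cdf_atBot μ) (quantileOf (cdf μ) q)
  rw [measure_cdf, sub_zero] at h
  rw [Measure.real, h]
  refine ENNReal.toReal_le_of_le_ofReal hq.1.le (ENNReal.ofReal_le_ofReal ?_)
  refine le_of_tendsto ((monotone_cdf μ).tendsto_leftLim _) ?_
  filter_upwards [self_mem_nhdsWithin] with y hy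
  by_contra! h
  exact (Set.mem_Iio.1 hy).not_ge ((quantileOf_cdf_le_iff hq).2 h.le)

/-- **Glivenko–Cantelli**: the empirical distribution function converges uniformly. -/
theorem ae_tendstoUniformly_empiricalCDF (hm : ∀ n, Measurable (D n)) (hi : iIndepFun D P)
    (hd : ∀ n, IdentDistrib (D n) (D 0) P P) :
    ∀ᵐ ω ∂P, TendstoUniformly (fun N => empiricalCDF (fun n => D n ω) N)
      (cdf (P.map (D 0))) atTop := by
  have := Measure.isProbabilityMeasure_map (μ := P) (hm 0).aemeasurable
  set F := cdf (P.map (D 0)) with hF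
  -- Rational levels give one null set serving every grid `k / m`. Open half-lines are needed as
  -- well because `F` may jump.
  have h1 : ∀ᵐ ω ∂P, ∀ r : ℚ, Tendsto (fun N : ℕ =>
      hitCount (fun n => D n ω) (Set.Iic (quantileOf F r)) N / N) atTop
      (𝓝 (P.real (D 0 ⁻¹' Set.Iic (quantileOf F r)))) :=
    ae_all_iff.2 fun r => ae_tendsto_hitCount_div hm hi hd measurableSet_Iic
  have h2 : ∀ᵐ ω ∂P, ∀ r : ℚ, Tendsto (fun N : ℕ =>
      hitCount (fun n => D n ω) (Set.Iio (quantileOf F r)) N / N) atTop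
      (𝓝 (P.real (D 0 ⁻¹' Set.Iio (quantileOf F r)))) :=
    ae_all_iff.2 fun r => ae_tendsto_hitCount_div hm hi hd measurableSet_Iio
  filter_upwards [h1, h2] with ω hω1 hω2
  rw [Metric.tendstoUniformly_iff]
  intro ε hε
  -- The error is at most `1 / m` from the grid plus `1 / m` from the strong law.
  obtain ⟨m, hm1⟩ := exists_nat_gt (2 / ε)
  have hm0 : (0 : ℝ) < m := lt_trans (by positivity) hm1
  have hmε : 2 / (m : ℝ) < ε := by
    rw [div_lt_iff₀ hε] at hm1
    rw [div_lt_iff₀ hm0]; linarith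
  have hinv : 0 < 1 / (m : ℝ) := by positivity
  have hq : ∀ k : ℕ, 1 ≤ k → k < m → (((k / m : ℚ)) : ℝ) ∈ Set.Ioo (0 : ℝ) 1 := by
    intro k hk hkm
    have : (0 : ℝ) < k := by exact_mod_cast hk
    have : (k : ℝ) < m := by exact_mod_cast hkm
    push_cast
    exact ⟨by positivity, (div_lt_one hm0).2 this⟩
  have hev : ∀ᶠ N : ℕ in atTop, ∀ k ∈ Finset.range m,
      dist (hitCount (fun n => D n ω) (Set.Iic (quantileOf F ((k / m : ℚ) : ℝ))) N / N)
        (P.real (D 0 ⁻¹' Set.Iic (quantileOf F ((k / m : ℚ) : ℝ)))) < 1 / m ∧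
      dist (hitCount (fun n => D n ω) (Set.Iio (quantileOf F ((k / m : ℚ) : ℝ))) N / N)
        (P.real (D 0 ⁻¹' Set.Iio (quantileOf F ((k / m : ℚ) : ℝ)))) < 1 / m := by
    rw [Finset.eventually_all]
    intro k _
    exact (Metric.tendsto_nhds.1 (hω1 _) _ hinv).and (Metric.tendsto_nhds.1 (hω2 _) _ hinv)
  filter_upwards [hev] with N hN x
  refine lt_trans ?_ hmε
  have e2 : 2 / (m : ℝ) = 1 / m + 1 / m := by ring
  have hFx0 : 0 ≤ F x := cdf_nonneg _ x
  have hFx1 : F x ≤ 1 := cdf_le_one _ x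
  rw [Real.dist_eq, abs_lt]
  constructor
  -- The least `k` with `F x < k / m`: then `x` lies strictly left of the `k / m`-quantile. If `k ≥
  -- m`, the trivial bound by 1 is enough.
  · obtain ⟨k, hk1, hk2⟩ : ∃ k : ℕ, m * F x < k ∧ (k : ℝ) ≤ m * F x + 1 :=
      ⟨⌊m * F x⌋₊ + 1, by exact_mod_cast Nat.lt_floor_add_one _, by
        push_cast; linarith [Nat.floor_le (show 0 ≤ m * F x by positivity)]⟩
    have hk2' : (k : ℝ) / m ≤ F x + 1 / m := by
      rw [div_le_iff₀ hm0]; field_simp; linarith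
    rcases le_or_gt m k with hkm | hkm
    · have : (1 : ℝ) ≤ k / m := by rw [le_div_iff₀ hm0]; simpa using hkm
      have := empiricalCDF_le_one (fun n => D n ω) N x
      linarith
    · have hkpos : 1 ≤ k := by
        have : (0 : ℝ) < k := lt_of_le_of_lt (by positivity) hk1
        exact_mod_cast this
      have hkq := hq k hkpos hkm
      have hlt : x < quantileOf F ((k / m : ℚ) : ℝ) := by
        by_contra! h
        have := (quantileOf_cdf_le_iff hkq).1 h
        push_cast at this
        rw [div_le_iff₀ hm0] at this
        linarith
      have hG := measureReal_Iio_quantileOf_cdf_le (μ := P.map (D 0)) hkq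
      rw [map_measureReal_apply (hm 0) measurableSet_Iio] at hG
      have hd2 := (hN k (Finset.mem_range.2 hkm)).2
      rw [Real.dist_eq, abs_lt] at hd2
      have hle : empiricalCDF (fun n => D n ω) N x
          ≤ hitCount (fun n => D n ω) (Set.Iio (quantileOf F ((k / m : ℚ) : ℝ))) N / N := by
        rw [empiricalCDF_eq_hitCount]
        gcongr
        exact hitCount_mono _ (fun y hy => lt_of_le_of_lt hy hlt) N
      push_cast at hG hd2 hle
      linarith [hd2.2]
  · rcases le_or_gt (m * F x) 1 with h | h
    · have : F x ≤ 1 / m := by rw [le_div_iff₀ hm0]; linarith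
      have := empiricalCDF_nonneg (fun n => D n ω) N x
      linarith
    -- The largest `k` strictly below `m * F x`; strictness ensures `k < m` even when `F x = 1`.
    · obtain ⟨k, hk1, hk2⟩ : ∃ k : ℕ, m * F x ≤ k + 1 ∧ (k : ℝ) < m * F x := by
        refine ⟨⌈m * F x⌉₊ - 1, ?_, ?_⟩
        · have := Nat.le_ceil (m * F x)
          have h3 : ⌈m * F x⌉₊ ≤ ⌈m * F x⌉₊ - 1 + 1 := by omega
          exact this.trans (by exact_mod_cast h3)
        · refine Nat.lt_ceil.1 ?_
          have : 0 < ⌈m * F x⌉₊ := Nat.ceil_pos.2 (by linarith)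
          omega
      have hkpos : 1 ≤ k := by
        have : (0 : ℝ) < k := by linarith
        exact_mod_cast this
      have hkm : k < m := by
        have : (k : ℝ) < m := by nlinarith
        exact_mod_cast this
      have hkq := hq k hkpos hkm
      have hk1' : F x ≤ k / m + 1 / m := by
        rw [← add_div, le_div_iff₀ hm0]; linarith
      have hle : quantileOf F ((k / m : ℚ) : ℝ) ≤ x := by
        refine (quantileOf_cdf_le_iff hkq).2 ?_
        push_cast
        rw [div_le_iff₀ hm0]
        linarith
      have hge := (quantileOf_cdf_le_iff (μ := P.map (D 0)) hkq).1 le_rfl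
      rw [cdf_map_eq (hm 0)] at hge
      have hd1 := (hN k (Finset.mem_range.2 hkm)).1
      rw [Real.dist_eq, abs_lt] at hd1
      have hle' := monotone_empiricalCDF (fun n => D n ω) N hle
      rw [empiricalCDF_eq_hitCount] at hle'
      push_cast at hge hd1 hle'
      linarith [hd1.1]

end GlivenkoCantelli

/-! ### From tail bounds to L² convergence and variances. -/

section WeakMoments

variable {Ω : Type*} [MeasurableSpace Ω] {P : Measure Ω} [IsProbabilityMeasure P]

/-- Adding the trivial bound 1 to `s ^ 2` times the tail bound yields a majorant integrable on the
whole half-line, including near 0. -/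
lemma measure_lt_sq_le_of_tail {W : Ω → ℝ} {C s : ℝ} (hs : 0 < s)
    (h : ∀ t > 0, P.real {ω | t < |W ω|} ≤ C / t ^ 4) :
    P {ω | s < W ω ^ 2} ≤ ENNReal.ofReal ((1 + C) * (1 + s ^ 2)⁻¹) := by
  have e : {ω | s < W ω ^ 2} = {ω | √s < |W ω|} := by
    ext ω
    rw [Set.mem_ofPred_eq, Set.mem_ofPred_eq, Real.sqrt_lt hs.le (abs_nonneg _), sq_abs]
  have h1 : P.real {ω | s < W ω ^ 2} ≤ 1 := measureReal_le_one
  have h2 : P.real {ω | s < W ω ^ 2} ≤ C / s ^ 2 := by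
    rw [e]
    refine (h _ (Real.sqrt_pos.2 hs)).trans (le_of_eq ?_)
    rw [show √s ^ 4 = (√s ^ 2) ^ 2 by ring, Real.sq_sqrt hs.le]
  rw [← ofReal_measureReal]
  refine ENNReal.ofReal_le_ofReal ?_
  rw [← div_eq_mul_inv, le_div_iff₀ (by positivity)]
  rw [le_div_iff₀ (by positivity)] at h2
  linarith

lemma lintegral_tail_bound_lt_top (C : ℝ) :
    ∫⁻ s in Set.Ioi (0 : ℝ), ENNReal.ofReal ((1 + C) * (1 + s ^ 2)⁻¹) < ⊤ :=
  (integrable_inv_one_add_sq.const_mul (1 + C)).restrict.lintegral_lt_top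

lemma memLp_two_of_tail {W : Ω → ℝ} (hW : Measurable W) {C : ℝ}
    (h : ∀ t > 0, P.real {ω | t < |W ω|} ≤ C / t ^ 4) : MemLp W 2 P := by
  rw [memLp_two_iff_integrable_sq hW.aestronglyMeasurable]
  refine ⟨(hW.pow_const 2).aestronglyMeasurable, ?_⟩
  rw [hasFiniteIntegral_iff_ofReal (ae_of_all _ fun ω => sq_nonneg _),
    lintegral_eq_lintegral_meas_lt _ (ae_of_all _ fun ω => sq_nonneg _)
      (hW.pow_const 2).aemeasurable]
  refine lt_of_le_of_lt (setLIntegral_mono' measurableSet_Ioi fun s hs => ?_)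
    (lintegral_tail_bound_lt_top C)
  exact measure_lt_sq_le_of_tail hs h

/-- Convergence in probability to zero with uniform fourth-power tails is convergence in `L²`. -/
lemma tendsto_integral_sq_of_tail {W : ℕ → Ω → ℝ} {C : ℝ} {N₀ : ℕ}
    (hW : ∀ N, N₀ ≤ N → Measurable (W N))
    (h : ∀ N, N₀ ≤ N → ∀ t > 0, P.real {ω | t < |W N ω|} ≤ C / t ^ 4)
    (h0 : ∀ t > 0, Tendsto (fun N => P.real {ω | t < |W N ω|}) atTop (𝓝 0)) :
    Tendsto (fun N => ∫ ω, W N ω ^ 2 ∂P) atTop (𝓝 0) := by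
  have key : Tendsto (fun N => ∫⁻ s in Set.Ioi (0 : ℝ), P {ω | s < W N ω ^ 2}) atTop
      (𝓝 (∫⁻ _ in Set.Ioi (0 : ℝ), 0)) := by
    refine tendsto_lintegral_filter_of_dominated_convergence _ ?_ ?_
      (lintegral_tail_bound_lt_top C).ne ?_
    · refine Eventually.of_forall fun N => Antitone.measurable fun s t hst => ?_
      exact measure_mono fun ω (hω : t < W N ω ^ 2) => lt_of_le_of_lt hst hω
    · filter_upwards [eventually_ge_atTop N₀] with N hN
      refine (ae_restrict_mem measurableSet_Ioi).mono fun s hs => ?_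
      exact measure_lt_sq_le_of_tail hs (h N hN)
    · refine (ae_restrict_mem measurableSet_Ioi).mono fun s hs => ?_
      have h1 := ENNReal.tendsto_ofReal (h0 (√s) (Real.sqrt_pos.2 hs))
      rw [ENNReal.ofReal_zero] at h1
      refine h1.congr fun N => ?_
      rw [ofReal_measureReal]
      congr 1
      ext ω
      rw [Set.mem_ofPred_eq, Set.mem_ofPred_eq, Real.sqrt_lt (le_of_lt hs) (abs_nonneg _), sq_abs]
  rw [lintegral_zero] at key
  have := (ENNReal.tendsto_toReal ENNReal.zero_ne_top).comp key
  refine this.congr' ?_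
  filter_upwards [eventually_ge_atTop N₀] with N hN
  rw [Function.comp_apply, integral_eq_lintegral_of_nonneg_ae (ae_of_all _ fun ω => sq_nonneg _)
    ((hW N hN).pow_const 2).aestronglyMeasurable,
    lintegral_eq_lintegral_meas_lt _ (ae_of_all _ fun ω => sq_nonneg _)
      ((hW N hN).pow_const 2).aemeasurable]

/-- Cauchy–Schwarz, from the discriminant of the nonnegative quadratic `t ↦ Var (t * X + Y)`. -/
lemma sq_covariance_le {X Y : Ω → ℝ} (hX : MemLp X 2 P) (hY : MemLp Y 2 P) :
    covariance X Y P ^ 2 ≤ variance X P * variance Y P := by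
  have h : ∀ t : ℝ, 0 ≤ variance X P * (t * t) + 2 * covariance X Y P * t + variance Y P := by
    intro t
    have h1 := variance_nonneg (fun ω => t * X ω + Y ω) P
    rw [variance_fun_add (hX.const_mul t) hY, variance_const_mul, covariance_const_mul_left] at h1
    linarith
  have := discrim_le_zero h
  rw [discrim] at this
  linarith

/-- An `L²`-small perturbation does not change the limit of the variance. -/
lemma tendsto_variance_of_tendsto_integral_sub_sq {Y Z : ℕ → Ω → ℝ} {v : ℝ} {N₀ : ℕ}
    (hY : ∀ N, N₀ ≤ N → MemLp (Y N) 2 P) (hZ : ∀ N, N₀ ≤ N → MemLp (Z N) 2 P)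
    (hv : ∀ N, N₀ ≤ N → variance (Z N) P = v)
    (h : Tendsto (fun N => ∫ ω, (Y N ω - Z N ω) ^ 2 ∂P) atTop (𝓝 0)) :
    Tendsto (fun N => variance (Y N) P) atTop (𝓝 v) := by
  have hW : ∀ N, N₀ ≤ N → MemLp (fun ω => Y N ω - Z N ω) 2 P :=
    fun N hN => (hY N hN).sub (hZ N hN)
  have hvW : Tendsto (fun N => variance (fun ω => Y N ω - Z N ω) P) atTop (𝓝 0) := by
    refine squeeze_zero' (Eventually.of_forall fun N => variance_nonneg _ _) ?_ h
    filter_upwards [eventually_ge_atTop N₀] with N hN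
    exact variance_le_expectation_sq (hW N hN).aestronglyMeasurable
  have hcov : Tendsto (fun N => covariance (fun ω => Y N ω - Z N ω) (Z N) P) atTop (𝓝 0) := by
    have hs : Tendsto (fun N => √(variance (fun ω => Y N ω - Z N ω) P * v)) atTop (𝓝 0) := by
      simpa using (hvW.mul_const v).sqrt
    refine squeeze_zero_norm' ?_ hs
    filter_upwards [eventually_ge_atTop N₀] with N hN
    rw [← hv N hN]
    exact Real.abs_le_sqrt (sq_covariance_le (hW N hN) (hZ N hN))
  have hsum := (hvW.add (hcov.const_mul 2)).add_const v
  simp only [mul_zero, add_zero, zero_add] at hsum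
  refine hsum.congr' ?_
  filter_upwards [eventually_ge_atTop N₀] with N hN
  rw [← hv N hN, ← variance_fun_add (hW N hN) (hZ N hN)]
  simp

end WeakMoments

/-! ### Deterministic estimates. -/

section RealEstimates

lemma HasDerivAt.exists_linear_growth {F : ℝ → ℝ} {f ξ : ℝ} (h : HasDerivAt F f ξ) (hf : 0 < f) :
    ∃ ε > 0, ∀ u, 0 ≤ u → u ≤ ε →
      F ξ + f / 2 * u ≤ F (ξ + u) ∧ F (ξ - u) ≤ F ξ - f / 2 * u := by
  have h1 := (hasDerivAt_iff_isLittleO.1 h).def (half_pos hf)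
  obtain ⟨ε, hε, hb⟩ := Metric.eventually_nhds_iff.1 h1
  refine ⟨ε / 2, half_pos hε, fun u hu huε => ⟨?_, ?_⟩⟩
  · have := hb (y := ξ + u) (by rw [Real.dist_eq, add_sub_cancel_left, abs_of_nonneg hu]; linarith)
    rw [add_sub_cancel_left, Real.norm_eq_abs, Real.norm_eq_abs, abs_of_nonneg hu, smul_eq_mul,
      abs_le] at this
    linarith [this.1]
  · have e : ξ - u - ξ = -u := by ring
    have := hb (y := ξ - u) (by rw [Real.dist_eq, e, abs_neg, abs_of_nonneg hu]; linarith)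
    rw [e, Real.norm_eq_abs, Real.norm_eq_abs, abs_neg, abs_of_nonneg hu, smul_eq_mul,
      abs_le] at this
    linarith [this.2]

lemma exp_neg_le_two_div_sq {x : ℝ} (hx : 0 < x) : Real.exp (-x) ≤ 2 / x ^ 2 := by
  have := Real.quadratic_le_exp_of_nonneg hx.le
  rw [Real.exp_neg, inv_le_comm₀ (Real.exp_pos _) (by positivity), inv_div]
  linarith

/-- The Chernoff bound for a power tail beats any power once `N` and `u` are large. -/
lemma exists_chernoff_power_bound {K δ r : ℝ} (hK : 0 < K) (hδ : 0 < δ) (hr : 0 < r) :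
    ∃ M > 0, ∃ C ≥ 0, ∃ N₀ : ℕ, ∀ u, M ≤ u → K * u ^ (-δ) ≤ 1 ∧ ∀ N : ℕ, N₀ ≤ N →
      (2 * (K * u ^ (-δ)) ^ r) ^ N ≤ C / (N ^ 2 * u ^ 4) := by
  -- Half of the decay `u ^ (-δ * r)` absorbs the constant `2 * K ^ r`; the other half, `u ^ (-b)`,
  -- remains.
  set b := δ * r / 2 with hb
  have hb0 : 0 < b := by positivity
  have h1 : ∀ᶠ u : ℝ in atTop, K * u ^ (-δ) ≤ 1 := by
    have := (tendsto_rpow_neg_atTop hδ).const_mul K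
    rw [mul_zero] at this
    exact this.eventually_le_const one_pos
  have h2 : ∀ᶠ u : ℝ in atTop, 2 * K ^ r ≤ u ^ b :=
    (tendsto_rpow_atTop hb0).eventually_ge_atTop _
  obtain ⟨M, hM⟩ := eventually_atTop.1
    ((h1.and h2).and (eventually_ge_atTop (Real.exp 1)))
  -- Once `b * N ≥ 8` and `log u ≥ 1`, one half of `b * N * log u` supplies `4 * log u` and the
  -- other supplies `b * N / 2`.
  obtain ⟨N₀, hN₀⟩ := exists_nat_ge (8 / b)
  refine ⟨M, (Real.exp_pos 1).trans_le (hM M le_rfl).2, 8 / b ^ 2, by positivity, max N₀ 1,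
    fun u hu => ⟨(hM u hu).1.1, fun N hN => ?_⟩⟩
  obtain ⟨⟨-, hu2⟩, hu3⟩ := hM u hu
  have hu0 : 0 < u := (Real.exp_pos 1).trans_le hu3
  have hL : 1 ≤ Real.log u := (Real.le_log_iff_exp_le hu0).2 hu3
  have hN1 : (1 : ℝ) ≤ N := by exact_mod_cast (le_max_right _ _).trans hN
  have hbN : 8 ≤ b * N := by
    have : (N₀ : ℝ) ≤ N := by exact_mod_cast (le_max_left _ _).trans hN
    have := hN₀.trans this
    rw [div_le_iff₀ hb0] at this
    linarith
  have hle : 2 * (K * u ^ (-δ)) ^ r ≤ Real.exp (-(b * Real.log u)) := by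
    have e1 : u ^ b = Real.exp (b * Real.log u) := by rw [Real.rpow_def_of_pos hu0, mul_comm]
    have e2 : (u ^ (-δ)) ^ r = Real.exp (-(b * Real.log u)) * Real.exp (-(b * Real.log u)) := by
      rw [← Real.rpow_mul hu0.le, Real.rpow_def_of_pos hu0, ← Real.exp_add, hb]
      congr 1; ring
    rw [Real.mul_rpow hK.le (Real.rpow_nonneg hu0.le _), e2]
    rw [e1] at hu2
    calc 2 * (K ^ r * (Real.exp (-(b * Real.log u)) * Real.exp (-(b * Real.log u))))
        = 2 * K ^ r * (Real.exp (-(b * Real.log u)) * Real.exp (-(b * Real.log u))) := by ring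
      _ ≤ Real.exp (b * Real.log u)
          * (Real.exp (-(b * Real.log u)) * Real.exp (-(b * Real.log u))) := by gcongr
      _ = Real.exp (-(b * Real.log u)) := by
          rw [← Real.exp_add, ← Real.exp_add]; congr 1; ring
  have hexp : (Real.exp (-(b * Real.log u))) ^ N
      ≤ Real.exp (-(4 * Real.log u)) * Real.exp (-(b * N / 2)) := by
    rw [← Real.exp_nat_mul, ← Real.exp_add]
    refine Real.exp_le_exp.2 ?_
    nlinarith
  have hu4 : Real.exp (-(4 * Real.log u)) = (u ^ 4)⁻¹ := by
    rw [Real.exp_neg, show 4 * Real.log u = ((4 : ℕ) : ℝ) * Real.log u by norm_num,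
      Real.exp_nat_mul, Real.exp_log hu0]
  calc (2 * (K * u ^ (-δ)) ^ r) ^ N ≤ (Real.exp (-(b * Real.log u))) ^ N := by gcongr
    _ ≤ (u ^ 4)⁻¹ * Real.exp (-(b * N / 2)) := by rwa [← hu4]
    _ ≤ (u ^ 4)⁻¹ * (2 / (b * N / 2) ^ 2) := by
        gcongr
        exact exp_neg_le_two_div_sq (by positivity)
    _ = 8 / b ^ 2 / (N ^ 2 * u ^ 4) := by field_simp; ring

end RealEstimates

/-! ### Tail bounds and consistency of the empirical quantile. -/

section QuantileTails

lemma cdf_quantileOf_eq {μ : Measure ℝ} {q : ℝ} (hq : q ∈ Set.Ioo (0 : ℝ) 1)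
    (hc : ContinuousAt (cdf μ) (quantileOf (cdf μ) q)) : cdf μ (quantileOf (cdf μ) q) = q := by
  refine le_antisymm ?_ ((quantileOf_cdf_le_iff hq).1 le_rfl)
  refine le_of_tendsto (hc.tendsto.mono_left (nhdsWithin_le_nhds (s := Set.Iio (quantileOf (cdf μ) q)))) ?_
  filter_upwards [self_mem_nhdsWithin] with y hy
  by_contra! h
  exact (Set.mem_Iio.1 hy).not_ge ((quantileOf_cdf_le_iff hq).2 h.le)

variable {Ω : Type*} [MeasurableSpace Ω] {P : Measure Ω} [IsProbabilityMeasure P]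
  {D : ℕ → Ω → ℝ}

/-- Gaussian tails of the empirical quantile where the distribution function grows linearly. -/
lemma empiricalQuantile_tail_near (hm : ∀ n, Measurable (D n)) (hi : iIndepFun D P)
    (hd : ∀ n, IdentDistrib (D n) (D 0) P P) {q ξ u v : ℝ} (hq : q ∈ Set.Ioo (0 : ℝ) 1)
    (hv : 0 ≤ v) (hup : q + v ≤ cdf (P.map (D 0)) (ξ + u))
    (hlo : cdf (P.map (D 0)) (ξ - u) ≤ q - v) {N : ℕ} (hN : 0 < N) :
    P.real {ω | u < |empiricalQuantile (fun n => D n ω) N q - ξ|}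
      ≤ 2 * Real.exp (-2 * N * v ^ 2) := by
  rw [cdf_map_eq (hm 0)] at hup hlo
  have hN' : (0 : ℝ) < N := by exact_mod_cast hN
  have hsub : {ω | u < |empiricalQuantile (fun n => D n ω) N q - ξ|}
      ⊆ {ω | hitCount (fun n => D n ω) (Set.Iic (ξ + u)) N
          ≤ N * (P.real (D 0 ⁻¹' Set.Iic (ξ + u)) - v)}
        ∪ {ω | N * (P.real (D 0 ⁻¹' Set.Iic (ξ - u)) + v)
          ≤ hitCount (fun n => D n ω) (Set.Iic (ξ - u)) N} := by
    intro ω hω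
    rcases lt_abs.1 (show u < |empiricalQuantile (fun n => D n ω) N q - ξ| from hω) with h | h
    · left
      have h1 : ¬ empiricalQuantile (fun n => D n ω) N q ≤ ξ + u := by linarith
      rw [empiricalQuantile_le_iff _ hN hq, not_le] at h1
      refine h1.le.trans ?_
      gcongr
      linarith
    · right
      have h1 : empiricalQuantile (fun n => D n ω) N q ≤ ξ - u := by linarith
      rw [empiricalQuantile_le_iff _ hN hq] at h1
      refine le_trans ?_ h1
      gcongr
      linarith
  refine (measureReal_mono hsub).trans ((measureReal_union_le _ _).trans ?_)
  rw [two_mul]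
  exact add_le_add (hitCount_lower_tail hm hi hd measurableSet_Iic N hv)
    (hitCount_upper_tail hm hi hd measurableSet_Iic N hv)

/-- If the empirical quantile is far from `ξ`, then so is a positive fraction of the sample. -/
lemma empiricalQuantile_tail_far (hm : ∀ n, Measurable (D n)) (hi : iIndepFun D P)
    (hd : ∀ n, IdentDistrib (D n) (D 0) P P) {q ξ u a : ℝ} (hq : q ∈ Set.Ioo (0 : ℝ) 1)
    (ha : 0 < a) (ha1 : a ≤ 1) (hp : P.real {ω | u ≤ |D 0 ω - ξ|} ≤ a) {N : ℕ} (hN : 0 < N) :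
    P.real {ω | u < |empiricalQuantile (fun n => D n ω) N q - ξ|}
      ≤ (2 * a ^ (min q (1 - q))) ^ N := by
  have hB : MeasurableSet {x : ℝ | u ≤ |x - ξ|} :=
    measurableSet_le measurable_const (measurable_id.sub_const ξ).abs
  refine le_trans (measureReal_mono fun ω hω => ?_)
    (hitCount_chernoff hm hi hd hB N (r := min q (1 - q)) ha ha1 hp)
  have hN' : (0 : ℝ) ≤ N := Nat.cast_nonneg N
  rcases lt_abs.1 (show u < |empiricalQuantile (fun n => D n ω) N q - ξ| from hω) with h | h
  · have h1 : ¬ empiricalQuantile (fun n => D n ω) N q ≤ ξ + u := by linarith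
    rw [empiricalQuantile_le_iff _ hN hq, not_le] at h1
    have h2 := hitCount_compl (fun n => D n ω) (Set.Iic (ξ + u)) N
    have h3 : hitCount (fun n => D n ω) (Set.Iic (ξ + u))ᶜ N
        ≤ hitCount (fun n => D n ω) {x : ℝ | u ≤ |x - ξ|} N := by
      refine hitCount_mono _ (fun x hx => ?_) N
      have : ξ + u < x := not_le.1 hx
      have h4 : u ≤ x - ξ := by linarith
      exact le_abs.2 (Or.inl h4)
    have h4 : min q (1 - q) * N ≤ (1 - q) * N := by gcongr; exact min_le_right _ _
    show min q (1 - q) * N ≤ hitCount (fun n => D n ω) {x : ℝ | u ≤ |x - ξ|} N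
    linarith
  · have h1 : empiricalQuantile (fun n => D n ω) N q ≤ ξ - u := by linarith
    rw [empiricalQuantile_le_iff _ hN hq] at h1
    have h3 : hitCount (fun n => D n ω) (Set.Iic (ξ - u)) N
        ≤ hitCount (fun n => D n ω) {x : ℝ | u ≤ |x - ξ|} N := by
      refine hitCount_mono _ (fun x hx => ?_) N
      have : x ≤ ξ - u := hx
      have h4 : u ≤ -(x - ξ) := by linarith
      exact le_abs.2 (Or.inr h4)
    have h4 : min q (1 - q) * N ≤ q * N := by gcongr; exact min_le_left _ _
    show min q (1 - q) * N ≤ hitCount (fun n => D n ω) {x : ℝ | u ≤ |x - ξ|} N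
    linarith

/-- A fractional moment gives a power tail around any centre. -/
lemma exists_power_tail {X : Ω → ℝ} {δ : ℝ} (hδ : 0 < δ)
    (hX : Integrable (fun ω => |X ω| ^ δ) P) (ξ : ℝ) :
    ∃ K > 0, ∀ u > 0, 2 * |ξ| ≤ u → P.real {ω | u ≤ |X ω - ξ|} ≤ K * u ^ (-δ) := by
  have hE : 0 ≤ ∫ ω, |X ω| ^ δ ∂P := integral_nonneg fun ω => by positivity
  -- Markov at `u / 2`: the triangle inequality gives `|X| ≥ u / 2` because `|ξ| ≤ u / 2`. The `+ 1`
  -- only makes the constant positive.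
  refine ⟨2 ^ δ * ∫ ω, |X ω| ^ δ ∂P + 1, by positivity, fun u hu hξ => ?_⟩
  have h1 := mul_meas_ge_le_integral_of_nonneg (ae_of_all P fun ω => by positivity) hX
    ((u / 2) ^ δ)
  have h2 : P.real {ω | u ≤ |X ω - ξ|} ≤ P.real {ω | (u / 2) ^ δ ≤ |X ω| ^ δ} := by
    refine measureReal_mono fun ω hω => ?_
    have hω' : u ≤ |X ω - ξ| := hω
    have := abs_sub (X ω) ξ
    refine Real.rpow_le_rpow (by positivity) ?_ hδ.le
    linarith
  have h3 : 0 < u ^ δ := Real.rpow_pos_of_pos hu δ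
  have h4 : (0 : ℝ) < 2 ^ δ := by positivity
  have h5 : P.real {ω | (u / 2) ^ δ ≤ |X ω| ^ δ} ≤ 2 ^ δ * (∫ ω, |X ω| ^ δ ∂P) * u ^ (-δ) := by
    rw [Real.div_rpow hu.le zero_le_two] at h1 ⊢
    rw [div_mul_eq_mul_div, div_le_iff₀ h4] at h1
    rw [Real.rpow_neg hu.le, ← div_eq_mul_inv, le_div_iff₀ h3]
    linarith
  refine h2.trans (h5.trans ?_)
  have : 0 ≤ u ^ (-δ) := Real.rpow_nonneg hu.le _
  nlinarith

/-- Uniform fourth-power tails of the rescaled empirical quantile. -/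
theorem exists_scaled_empiricalQuantile_tail (hm : ∀ n, Measurable (D n)) (hi : iIndepFun D P)
    (hd : ∀ n, IdentDistrib (D n) (D 0) P P) {q f δ : ℝ} (hq : q ∈ Set.Ioo (0 : ℝ) 1)
    (hf : 0 < f) (hF : HasDerivAt (cdf (P.map (D 0))) f (quantileOf (cdf (P.map (D 0))) q))
    (hδ : 0 < δ) (hmom : Integrable (fun ω => |D 0 ω| ^ δ) P) :
    ∃ C, ∃ N₀ : ℕ, 0 < N₀ ∧ ∀ N, N₀ ≤ N → ∀ t > 0,
      P.real {ω | t < |√N * (empiricalQuantile (fun n => D n ω) N q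
        - quantileOf (cdf (P.map (D 0))) q)|} ≤ C / t ^ 4 := by
  set ξ := quantileOf (cdf (P.map (D 0))) q
  obtain ⟨ε, hε, hgrow⟩ := hF.exists_linear_growth hf
  rw [cdf_quantileOf_eq hq hF.continuousAt] at hgrow
  obtain ⟨K, hK, hKtail⟩ := exists_power_tail hδ hmom ξ
  obtain ⟨M, hM, C, hC, N₀, hbound⟩ := exists_chernoff_power_bound hK hδ
    (r := min q (1 - q)) (lt_min hq.1 (sub_pos.2 hq.2))
  set M' := max M (2 * |ξ|)
  have hM' : 0 < M' := lt_max_of_lt_left hM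
  set C₁ := 1 / (f / 2) ^ 4
  have hC₁ : 0 ≤ C₁ := by positivity
  have near : ∀ N : ℕ, 0 < N → ∀ u, 0 < u → u ≤ ε →
      P.real {ω | u < |empiricalQuantile (fun n => D n ω) N q - ξ|} ≤ C₁ / (N ^ 2 * u ^ 4) := by
    intro N hN u hu huε
    have hN' : (0 : ℝ) < N := by exact_mod_cast hN
    have h := empiricalQuantile_tail_near hm hi hd hq (ξ := ξ) (u := u) (v := f / 2 * u)
      (by positivity) (hgrow u hu.le huε).1 (hgrow u hu.le huε).2 hN
    refine h.trans ?_
    have := exp_neg_le_two_div_sq (x := 2 * N * (f / 2 * u) ^ 2) (by positivity)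
    calc 2 * Real.exp (-2 * N * (f / 2 * u) ^ 2)
        = 2 * Real.exp (-(2 * N * (f / 2 * u) ^ 2)) := by congr 2; ring
      _ ≤ 2 * (2 / (2 * N * (f / 2 * u) ^ 2) ^ 2) := by gcongr
      _ = C₁ / (N ^ 2 * u ^ 4) := by simp only [C₁]; field_simp
  -- Hoeffding covers `u ≤ ε` and Chernoff covers `u > M'`. In between, the tail at `u` is at most
  -- the tail at `ε`, at the cost of a factor `(M' / ε) ^ 4`.
  have unscaled : ∀ N : ℕ, max N₀ 1 ≤ N → ∀ u > 0,
      P.real {ω | u < |empiricalQuantile (fun n => D n ω) N q - ξ|}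
        ≤ (C₁ + C₁ * (M' / ε) ^ 4 + C) / (N ^ 2 * u ^ 4) := by
    intro N hN u hu
    have hN0 : 0 < N := (le_max_right _ _).trans hN
    have hN' : (0 : ℝ) < N := by exact_mod_cast hN0
    have hX : 0 ≤ C₁ * (M' / ε) ^ 4 := by positivity
    rcases le_or_gt u ε with h1 | h1
    · refine (near N hN0 u hu h1).trans ?_
      gcongr
      linarith
    rcases le_or_gt u M' with h2 | h2
    · have h3 : P.real {ω | u < |empiricalQuantile (fun n => D n ω) N q - ξ|}
          ≤ P.real {ω | ε < |empiricalQuantile (fun n => D n ω) N q - ξ|} :=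
        measureReal_mono fun ω hω => h1.trans hω
      refine h3.trans ((near N hN0 ε hε le_rfl).trans ?_)
      calc C₁ / (N ^ 2 * ε ^ 4) = C₁ * (u / ε) ^ 4 / (N ^ 2 * u ^ 4) := by field_simp
        _ ≤ (C₁ + C₁ * (M' / ε) ^ 4 + C) / (N ^ 2 * u ^ 4) := by
            have : C₁ * (u / ε) ^ 4 ≤ C₁ * (M' / ε) ^ 4 := by gcongr
            gcongr
            linarith
    · have h3 := hbound u ((le_max_left _ _).trans h2.le)
      have h4 := empiricalQuantile_tail_far hm hi hd hq (ξ := ξ) (u := u)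
        (by positivity) h3.1 (hKtail u hu ((le_max_right _ _).trans h2.le)) hN0
      refine h4.trans ((h3.2 N ((le_max_left _ _).trans hN)).trans ?_)
      gcongr
      linarith
  refine ⟨C₁ + C₁ * (M' / ε) ^ 4 + C, max N₀ 1, lt_max_of_lt_right one_pos, fun N hN t ht => ?_⟩
  have hN' : (0 : ℝ) < N := by exact_mod_cast (le_max_right _ _).trans hN
  have hs : 0 < √(N : ℝ) := Real.sqrt_pos.2 hN'
  have h := unscaled N hN (t / √N) (by positivity)
  have e : (N : ℝ) ^ 2 * (t / √N) ^ 4 = t ^ 4 := by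
    rw [div_pow, show √(N : ℝ) ^ 4 = (√(N : ℝ) ^ 2) ^ 2 by ring, Real.sq_sqrt hN'.le]
    field_simp
  rw [e] at h
  refine le_trans (le_of_eq ?_) h
  congr 1
  ext ω
  rw [Set.mem_ofPred_eq, Set.mem_ofPred_eq, abs_mul, abs_of_pos hs, div_lt_iff₀ hs, mul_comm]

/-- Consistency of the empirical quantile. -/
theorem tendsto_empiricalQuantile_tail (hm : ∀ n, Measurable (D n)) (hi : iIndepFun D P)
    (hd : ∀ n, IdentDistrib (D n) (D 0) P P) {q f u : ℝ} (hq : q ∈ Set.Ioo (0 : ℝ) 1)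
    (hf : 0 < f) (hF : HasDerivAt (cdf (P.map (D 0))) f (quantileOf (cdf (P.map (D 0))) q))
    (hu : 0 < u) :
    Tendsto (fun N : ℕ => P.real {ω | u < |empiricalQuantile (fun n => D n ω) N q
        - quantileOf (cdf (P.map (D 0))) q|}) atTop (𝓝 0) := by
  set ξ := quantileOf (cdf (P.map (D 0))) q
  obtain ⟨ε, hε, hgrow⟩ := hF.exists_linear_growth hf
  rw [cdf_quantileOf_eq hq hF.continuousAt] at hgrow
  set v := min u ε
  have hv : 0 < v := lt_min hu hε
  have hlim : Tendsto (fun N : ℕ => 2 * Real.exp (-2 * N * (f / 2 * v) ^ 2)) atTop (𝓝 0) := by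
    have h1 : Tendsto (fun N : ℕ => (2 * (f / 2 * v) ^ 2) * (N : ℝ)) atTop atTop :=
      tendsto_natCast_atTop_atTop.const_mul_atTop (by positivity)
    have h2 := (Real.tendsto_exp_neg_atTop_nhds_zero.comp h1).const_mul 2
    rw [mul_zero] at h2
    refine h2.congr fun N => ?_
    simp only [Function.comp_apply]
    congr 2; ring
  refine squeeze_zero' (Eventually.of_forall fun _ => measureReal_nonneg) ?_ hlim
  filter_upwards [eventually_gt_atTop 0] with N hN
  refine le_trans (measureReal_mono fun ω hω => lt_of_le_of_lt (min_le_left u ε) hω) ?_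
  exact empiricalQuantile_tail_near hm hi hd hq (by positivity)
    (hgrow v hv.le (min_le_right _ _)).1 (hgrow v hv.le (min_le_right _ _)).2 hN

end QuantileTails

/-! ### Bahadur–Ghosh linearisation. -/

/-- The empirical process at `t`, for the distribution function `F`, with reversed sign. -/
noncomputable def empiricalDeficit (F : ℝ → ℝ) (x : ℕ → ℝ) (N : ℕ) (t : ℝ) : ℝ :=
  (N * F t - hitCount x (Set.Iic t) N) / √N

lemma hitCount_Iic_add_Ioc (x : ℕ → ℝ) (N : ℕ) {s t : ℝ} (h : s ≤ t) :
    hitCount x (Set.Iic s) N + hitCount x (Set.Ioc s t) N = hitCount x (Set.Iic t) N := by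
  unfold hitCount
  rw [← Finset.sum_add_distrib]
  refine Finset.sum_congr rfl fun i _ => ?_
  rw [← Set.Iic_union_Ioc_eq_Iic h, Set.indicator_union_of_disjoint]
  exact Set.disjoint_left.2 fun y hy hy' => (not_lt.2 hy) hy'.1

/-- A difference quotient of `s ↦ F (ξ + s * (a / f))` along `s = 1 / √N`; parametrising by `s`
covers every sign of `a`, and `a = 0`. -/
lemma HasDerivAt.tendsto_sqrt_mul_increment {F : ℝ → ℝ} {f ξ : ℝ} (h : HasDerivAt F f ξ)
    (hf : f ≠ 0) (a : ℝ) :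
    Tendsto (fun N : ℕ => √N * (F (ξ + a / (f * √N)) - F ξ)) atTop (𝓝 a) := by
  have h1 : HasDerivAt (fun s => F (ξ + s * (a / f))) a 0 := by
    have hin : HasDerivAt (fun s : ℝ => ξ + s * (a / f)) (a / f) 0 := by
      simpa using ((hasDerivAt_id (0 : ℝ)).mul_const (a / f)).const_add ξ
    have h' : HasDerivAt F f (ξ + 0 * (a / f)) := by simpa using h
    have := h'.comp (0 : ℝ) hin
    rwa [mul_div_cancel₀ a hf] at this
  have h2 : Tendsto (fun N : ℕ => (√(N : ℝ))⁻¹) atTop (𝓝[≠] 0) := by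
    refine tendsto_nhdsWithin_iff.2 ⟨?_, ?_⟩
    · exact tendsto_inv_atTop_zero.comp (Real.tendsto_sqrt_atTop.comp tendsto_natCast_atTop_atTop)
    · filter_upwards [eventually_gt_atTop 0] with N hN
      have : (0 : ℝ) < N := by exact_mod_cast hN
      exact (inv_pos.2 (Real.sqrt_pos.2 this)).ne'
  refine (h1.tendsto_slope_zero.comp h2).congr fun N => ?_
  simp only [Function.comp_apply, inv_inv, zero_add, zero_mul, add_zero, smul_eq_mul]
  congr 4
  rw [div_mul_eq_div_div, div_eq_mul_inv (a / f), mul_comm]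

section EmpiricalProcess

variable {Ω : Type*} [MeasurableSpace Ω] {P : Measure Ω} [IsProbabilityMeasure P]
  {D : ℕ → Ω → ℝ}

lemma measurable_empiricalDeficit (hm : ∀ n, Measurable (D n)) (F : ℝ → ℝ) (N : ℕ) (t : ℝ) :
    Measurable fun ω => empiricalDeficit F (fun n => D n ω) N t :=
  ((measurable_hitCount hm measurableSet_Iic N).const_sub _).div_const _

lemma memLp_empiricalDeficit (hm : ∀ n, Measurable (D n)) (F : ℝ → ℝ) (N : ℕ) (t : ℝ) :
    MemLp (fun ω => empiricalDeficit F (fun n => D n ω) N t) 2 P := by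
  have := ((memLp_const (N * F t)).sub
    (memLp_hitCount (P := P) hm (measurableSet_Iic (a := t)) N 2)).const_mul (√N)⁻¹
  refine this.congr_norm (measurable_empiricalDeficit hm F N t).aestronglyMeasurable
    (ae_of_all _ fun ω => ?_)
  simp only [empiricalDeficit, div_eq_inv_mul, Pi.sub_apply]

lemma variance_empiricalDeficit (hm : ∀ n, Measurable (D n)) (hi : iIndepFun D P)
    (hd : ∀ n, IdentDistrib (D n) (D 0) P P) {N : ℕ} (hN : 0 < N) (t : ℝ) :
    variance (fun ω => empiricalDeficit (cdf (P.map (D 0))) (fun n => D n ω) N t) P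
      = cdf (P.map (D 0)) t * (1 - cdf (P.map (D 0)) t) := by
  have hN' : (0 : ℝ) < N := by exact_mod_cast hN
  simp only [empiricalDeficit, div_eq_inv_mul]
  rw [variance_const_mul, variance_const_sub
    (measurable_hitCount hm measurableSet_Iic N).aestronglyMeasurable,
    variance_hitCount hm hi hd measurableSet_Iic, ← cdf_map_eq (hm 0), inv_pow,
    Real.sq_sqrt hN'.le, inv_mul_cancel_left₀ hN'.ne']

/-- Chebyshev's inequality for hit counts. -/
lemma hitCount_chebyshev (hm : ∀ n, Measurable (D n)) (hi : iIndepFun D P)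
    (hd : ∀ n, IdentDistrib (D n) (D 0) P P) {B : Set ℝ} (hB : MeasurableSet B) {N : ℕ}
    (hN : 0 < N) {η : ℝ} (hη : 0 < η) :
    P.real {ω | η ≤ |(N * P.real (D 0 ⁻¹' B) - hitCount (fun n => D n ω) B N) / √N|}
      ≤ P.real (D 0 ⁻¹' B) / η ^ 2 := by
  have hN' : (0 : ℝ) < N := by exact_mod_cast hN
  have hs : 0 < √(N : ℝ) := Real.sqrt_pos.2 hN'
  have h := meas_ge_le_variance_div_sq (memLp_hitCount (P := P) hm hB N 2)
    (c := η * √N) (by positivity)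
  rw [integral_hitCount hm hd hB, variance_hitCount hm hi hd hB, mul_pow,
    Real.sq_sqrt hN'.le] at h
  set p := P.real (D 0 ⁻¹' B)
  have hp0 : 0 ≤ p := measureReal_nonneg
  have hp1 : p ≤ 1 := measureReal_le_one
  have e : {ω | η ≤ |(N * p - hitCount (fun n => D n ω) B N) / √N|}
      = {ω | η * √N ≤ |hitCount (fun n => D n ω) B N - N * p|} := by
    ext ω
    rw [Set.mem_ofPred_eq, Set.mem_ofPred_eq, abs_div, abs_of_pos hs, le_div_iff₀ hs, abs_sub_comm]
  rw [e]
  refine (ENNReal.toReal_le_of_le_ofReal ?_ h).trans ?_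
  · have : 0 ≤ 1 - p := by linarith
    positivity
  · rw [mul_comm (η ^ 2), mul_div_mul_left _ _ hN'.ne']
    gcongr
    nlinarith

/-- The increment is the centred, rescaled hit count of the interval between `s` and `t`, so
Chebyshev applies. The bound vanishes as grid points approach a continuity point of `F`. -/
lemma empiricalDeficit_increment (hm : ∀ n, Measurable (D n)) (hi : iIndepFun D P)
    (hd : ∀ n, IdentDistrib (D n) (D 0) P P) {N : ℕ} (hN : 0 < N) {η : ℝ} (hη : 0 < η)
    (s t : ℝ) :
    P.real {ω | η ≤ |empiricalDeficit (cdf (P.map (D 0))) (fun n => D n ω) N t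
        - empiricalDeficit (cdf (P.map (D 0))) (fun n => D n ω) N s|}
      ≤ |cdf (P.map (D 0)) t - cdf (P.map (D 0)) s| / η ^ 2 := by
  wlog hst : s ≤ t generalizing s t
  · have := this t s (not_le.1 hst).le
    simpa only [abs_sub_comm] using this
  have hp : P.real (D 0 ⁻¹' Set.Ioc s t) = cdf (P.map (D 0)) t - cdf (P.map (D 0)) s := by
    rw [cdf_map_eq (hm 0), cdf_map_eq (hm 0), ← measureReal_sdiff
      (Set.preimage_mono (Set.Iic_subset_Iic.2 hst)) (hm 0 measurableSet_Iic), ← Set.preimage_sdiff,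
      Set.Iic_sdiff_Iic]
  have h := hitCount_chebyshev hm hi hd (measurableSet_Ioc (a := s) (b := t)) hN hη
  rw [hp] at h
  rw [abs_of_nonneg (sub_nonneg.2 (monotone_cdf _ hst))]
  refine le_trans (le_of_eq ?_) h
  congr 1
  ext ω
  have := hitCount_Iic_add_Ioc (fun n => D n ω) N hst
  rw [Set.mem_ofPred_eq, Set.mem_ofPred_eq, empiricalDeficit, empiricalDeficit, ← this, ← sub_div]
  ring_nf

lemma empiricalDeficit_tail (hm : ∀ n, Measurable (D n)) (hi : iIndepFun D P)
    (hd : ∀ n, IdentDistrib (D n) (D 0) P P) {N : ℕ} (hN : 0 < N) (s : ℝ) {t : ℝ} (ht : 0 < t) :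
    P.real {ω | t < |empiricalDeficit (cdf (P.map (D 0))) (fun n => D n ω) N s|} ≤ 1 / t ^ 4 := by
  have hN' : (0 : ℝ) < N := by exact_mod_cast hN
  have hs : 0 < √(N : ℝ) := Real.sqrt_pos.2 hN'
  have hss : √(N : ℝ) * √N = N := Real.mul_self_sqrt hN'.le
  have hε : 0 ≤ t / √N := by positivity
  have hNε : N * (t / √N) = t * √N := by field_simp; linarith
  have hsub : {ω | t < |empiricalDeficit (cdf (P.map (D 0))) (fun n => D n ω) N s|}
      ⊆ {ω | hitCount (fun n => D n ω) (Set.Iic s) N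
          ≤ N * (P.real (D 0 ⁻¹' Set.Iic s) - t / √N)}
        ∪ {ω | N * (P.real (D 0 ⁻¹' Set.Iic s) + t / √N)
          ≤ hitCount (fun n => D n ω) (Set.Iic s) N} := by
    intro ω hω
    rw [Set.mem_ofPred_eq, empiricalDeficit, cdf_map_eq (hm 0), lt_abs] at hω
    rcases hω with h | h
    · left
      rw [lt_div_iff₀ hs] at h
      rw [Set.mem_ofPred_eq, mul_sub, hNε]
      linarith
    · right
      rw [← neg_div, lt_div_iff₀ hs] at h
      rw [Set.mem_ofPred_eq, mul_add, hNε]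
      linarith
  refine (measureReal_mono hsub).trans ((measureReal_union_le _ _).trans ?_)
  refine (add_le_add (hitCount_lower_tail hm hi hd measurableSet_Iic N hε)
    (hitCount_upper_tail hm hi hd measurableSet_Iic N hε)).trans ?_
  have e : -2 * N * (t / √N) ^ 2 = -(2 * t ^ 2) := by
    rw [div_pow, Real.sq_sqrt hN'.le]; field_simp
  have := exp_neg_le_two_div_sq (x := 2 * t ^ 2) (by positivity)
  rw [e]
  calc Real.exp (-(2 * t ^ 2)) + Real.exp (-(2 * t ^ 2))
      ≤ 2 / (2 * t ^ 2) ^ 2 + 2 / (2 * t ^ 2) ^ 2 := add_le_add this this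
    _ = 1 / t ^ 4 := by field_simp; norm_num

/-- Pointwise comparison on a grid of mesh `ε`: the rescaled empirical quantile is within `2 ε` of
the empirical process at the quantile if the latter oscillates by less than `ε / 2` on the grid. -/
lemma abs_scaled_empiricalQuantile_sub_le {F : ℝ → ℝ} {x : ℕ → ℝ} {N k : ℕ} (hN : 0 < N)
    {q f ξ ε : ℝ} (hq : q ∈ Set.Ioo (0 : ℝ) 1) (hf : 0 < f) (hε : 0 < ε)
    (hZ : |empiricalDeficit F x N ξ| ≤ k * ε)
    (hgrid : ∀ j ∈ Finset.Icc (-(k + 2) : ℤ) (k + 2),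
      |empiricalDeficit F x N (ξ + j * ε / (f * √N)) - empiricalDeficit F x N ξ| < ε / 2)
    (hlin : ∀ j ∈ Finset.Icc (-(k + 2) : ℤ) (k + 2),
      |√N * (F (ξ + j * ε / (f * √N)) - q) - j * ε| < ε / 2) :
    |f * (√N * (empiricalQuantile x N q - ξ)) - empiricalDeficit F x N ξ| ≤ 2 * ε := by
  have hN' : (0 : ℝ) < N := by exact_mod_cast hN
  have hs : 0 < √(N : ℝ) := Real.sqrt_pos.2 hN'
  have hss : √(N : ℝ) * √N = N := Real.mul_self_sqrt hN'.le
  -- An exact restatement of the Galois connection in local coordinates; the right side is close to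
  -- `a` and the left close to `Z` at grid points.
  have hiff : ∀ a : ℝ, f * (√N * (empiricalQuantile x N q - ξ)) ≤ a ↔
      empiricalDeficit F x N (ξ + a / (f * √N)) ≤ √N * (F (ξ + a / (f * √N)) - q) := by
    intro a
    have h1 : f * (√N * (empiricalQuantile x N q - ξ)) ≤ a ↔
        empiricalQuantile x N q ≤ ξ + a / (f * √N) := by
      rw [← sub_le_iff_le_add', le_div_iff₀ (by positivity)]
      constructor <;> intro h <;> linarith
    rw [h1, empiricalQuantile_le_iff x hN hq, empiricalDeficit, div_le_iff₀ hs]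
    have : √N * (F (ξ + a / (f * √N)) - q) * √N = N * F (ξ + a / (f * √N)) - N * q := by
      linear_combination (F (ξ + a / (f * √N)) - q) * hss
    rw [this]
    constructor <;> intro h <;> linarith
  set Z := empiricalDeficit F x N ξ
  obtain ⟨hZ1, hZ2⟩ := abs_le.1 hZ
  -- Testing at `j + 2` and `j - 1` leaves a margin of at least `ε` from `Z`, which the two errors
  -- of `ε / 2` cannot exhaust. Hence the grid up to `k + 2`.
  set j := ⌊Z / ε⌋
  have hj1 : j * ε ≤ Z := (le_div_iff₀ hε).1 (Int.floor_le _)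
  have hj2 : Z < (j + 1) * ε := (div_lt_iff₀ hε).1 (Int.lt_floor_add_one _)
  have hjk : j ≤ k := by
    have : (j : ℝ) * ε ≤ k * ε := hj1.trans hZ2
    exact_mod_cast le_of_mul_le_mul_right this hε
  have hjk' : -(k : ℤ) < j + 1 := by
    have : (-k : ℝ) * ε < (j + 1) * ε := by linarith
    exact_mod_cast lt_of_mul_lt_mul_right this hε.le
  have hm1 : j + 2 ∈ Finset.Icc (-(k + 2) : ℤ) (k + 2) := Finset.mem_Icc.2 ⟨by omega, by omega⟩
  have hm2 : j - 1 ∈ Finset.Icc (-(k + 2) : ℤ) (k + 2) := Finset.mem_Icc.2 ⟨by omega, by omega⟩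
  have up : f * (√N * (empiricalQuantile x N q - ξ)) ≤ (j + 2 : ℤ) * ε := by
    rw [hiff]
    have h1 := (abs_lt.1 (hgrid _ hm1)).2
    have h2 := (abs_lt.1 (hlin _ hm1)).1
    have h3 : ((j + 2 : ℤ) : ℝ) * ε = (j + 1) * ε + ε := by push_cast; ring
    linarith
  have lo : ¬ f * (√N * (empiricalQuantile x N q - ξ)) ≤ (j - 1 : ℤ) * ε := by
    rw [hiff]
    have h1 := (abs_lt.1 (hgrid _ hm2)).1
    have h2 := (abs_lt.1 (hlin _ hm2)).2
    have h3 : ((j - 1 : ℤ) : ℝ) * ε = j * ε - ε := by push_cast; ring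
    linarith
  rw [not_le] at lo
  push_cast at up lo
  rw [abs_le]
  constructor <;> linarith

/-- The Bahadur–Ghosh representation of the empirical quantile. -/
theorem tendsto_bahadur_remainder (hm : ∀ n, Measurable (D n)) (hi : iIndepFun D P)
    (hd : ∀ n, IdentDistrib (D n) (D 0) P P) {q f : ℝ} (hq : q ∈ Set.Ioo (0 : ℝ) 1)
    (hf : 0 < f) (hF : HasDerivAt (cdf (P.map (D 0))) f (quantileOf (cdf (P.map (D 0))) q))
    {t : ℝ} (ht : 0 < t) :
    Tendsto (fun N : ℕ => P.real {ω | t < |f * (√N * (empiricalQuantile (fun n => D n ω) N q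
          - quantileOf (cdf (P.map (D 0))) q))
        - empiricalDeficit (cdf (P.map (D 0))) (fun n => D n ω) N
          (quantileOf (cdf (P.map (D 0))) q)|}) atTop (𝓝 0) := by
  have hFq := cdf_quantileOf_eq hq hF.continuousAt
  set F : ℝ → ℝ := ⇑(cdf (P.map (D 0)))
  set ξ := quantileOf F q
  set ε := t / 2 with hεt
  have hε : 0 < ε := half_pos ht
  have hlin : ∀ j : ℤ, Tendsto (fun N : ℕ => √N * (F (ξ + j * ε / (f * √N)) - q)) atTop
      (𝓝 (j * ε)) := by
    intro j
    have := hF.tendsto_sqrt_mul_increment hf.ne' (j * ε)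
    rwa [hFq] at this
  have hinc : ∀ j : ℤ, Tendsto (fun N : ℕ => |F (ξ + j * ε / (f * √N)) - F ξ| / (ε / 2) ^ 2)
      atTop (𝓝 0) := by
    intro j
    have h0 : Tendsto (fun N : ℕ => ξ + j * ε / (f * √N)) atTop (𝓝 ξ) := by
      have h1 : Tendsto (fun N : ℕ => f * √(N : ℝ)) atTop atTop :=
        (Real.tendsto_sqrt_atTop.comp tendsto_natCast_atTop_atTop).const_mul_atTop hf
      simpa using (h1.const_div_atTop (j * ε)).const_add ξ
    have h2 := ((hF.continuousAt.tendsto.comp h0).sub_const (F ξ)).abs.div_const ((ε / 2) ^ 2)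
    simpa using h2
  refine Metric.tendsto_nhds.2 fun η hη => ?_
  -- The tail bound for the deficit is free of `N`, so the grid can be fixed, and finite, before `N`
  -- grows.
  obtain ⟨k, hk⟩ : ∃ k : ℕ, 0 < k ∧ 1 / (k * ε) ^ 4 < η / 2 := by
    have h1 : Tendsto (fun k : ℕ => 1 / ((k : ℝ) * ε) ^ 4) atTop (𝓝 0) := by
      refine Tendsto.const_div_atTop ?_ 1
      exact (tendsto_pow_atTop (by norm_num)).comp
        (tendsto_natCast_atTop_atTop.atTop_mul_const hε)
    exact ((eventually_gt_atTop 0).and (h1.eventually_lt_const (half_pos hη))).exists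
  set J := Finset.Icc (-(k + 2) : ℤ) (k + 2)
  have hsum : Tendsto (fun N : ℕ => ∑ j ∈ J, |F (ξ + j * ε / (f * √N)) - F ξ| / (ε / 2) ^ 2)
      atTop (𝓝 0) := by
    simpa using tendsto_finsetSum J fun j _ => hinc j
  have hev : ∀ᶠ N : ℕ in atTop, ∀ j ∈ J,
      |√N * (F (ξ + j * ε / (f * √N)) - q) - j * ε| < ε / 2 :=
    (Finset.eventually_all J).2 fun j _ => Metric.tendsto_nhds.1 (hlin j) _ (half_pos hε)
  filter_upwards [eventually_gt_atTop 0, hev, hsum.eventually_lt_const (half_pos hη)]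
    with N hN hNlin hNsum
  rw [Real.dist_eq, sub_zero, abs_of_nonneg measureReal_nonneg]
  have hk' : (0 : ℝ) < k := by exact_mod_cast hk.1
  have hsub : {ω | t < |f * (√N * (empiricalQuantile (fun n => D n ω) N q - ξ))
        - empiricalDeficit F (fun n => D n ω) N ξ|}
      ⊆ {ω | k * ε < |empiricalDeficit F (fun n => D n ω) N ξ|}
        ∪ ⋃ j ∈ J, {ω | ε / 2 ≤ |empiricalDeficit F (fun n => D n ω) N (ξ + j * ε / (f * √N))
          - empiricalDeficit F (fun n => D n ω) N ξ|} := by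
    intro ω hω
    by_contra hcon
    simp only [Set.mem_union, Set.mem_iUnion, Set.mem_ofPred_eq, not_or, not_lt, not_exists,
      not_le] at hcon
    have := abs_scaled_empiricalQuantile_sub_le (F := F) hN hq hf hε hcon.1 hcon.2 hNlin
    rw [hεt, mul_div_cancel₀ t two_ne_zero] at this
    exact absurd hω this.not_gt
  calc _ ≤ 1 / (k * ε) ^ 4 + ∑ j ∈ J, |F (ξ + j * ε / (f * √N)) - F ξ| / (ε / 2) ^ 2 := by
        refine (measureReal_mono hsub).trans ((measureReal_union_le _ _).trans ?_)
        refine add_le_add (empiricalDeficit_tail hm hi hd hN ξ (by positivity)) ?_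
        refine (measureReal_biUnion_finset_le _ _).trans (Finset.sum_le_sum fun j _ => ?_)
        exact empiricalDeficit_increment hm hi hd hN (half_pos hε) _ _
    _ < η := by linarith [hk.2]

end EmpiricalProcess

/-! ### Asymptotic variance. -/

section VarianceAsymptotics

variable {Ω : Type*} [MeasurableSpace Ω] {P : Measure Ω} [IsProbabilityMeasure P]
  {D : ℕ → Ω → ℝ}

lemma measureReal_abs_add_tail {X Y : Ω → ℝ} {A B t : ℝ} (ht : 0 < t)
    (hX : ∀ t > 0, P.real {ω | t < |X ω|} ≤ A / t ^ 4)
    (hY : ∀ t > 0, P.real {ω | t < |Y ω|} ≤ B / t ^ 4) :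
    P.real {ω | t < |X ω - Y ω|} ≤ (16 * A + 16 * B) / t ^ 4 := by
  have hsub : {ω | t < |X ω - Y ω|} ⊆ {ω | t / 2 < |X ω|} ∪ {ω | t / 2 < |Y ω|} := by
    intro ω hω
    by_contra h
    simp only [Set.mem_union, Set.mem_ofPred_eq, not_or, not_lt] at h hω
    have := abs_sub (X ω) (Y ω)
    linarith [h.1, h.2]
  refine (measureReal_mono hsub).trans ((measureReal_union_le _ _).trans ?_)
  refine (add_le_add (hX _ (half_pos ht)) (hY _ (half_pos ht))).trans (le_of_eq ?_)
  field_simp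
  ring

/-- The empirical quantile is eventually square integrable, and its rescaled variance converges
to that of its Bahadur–Ghosh linearisation. -/
theorem empiricalQuantile_variance_asymptotics (hm : ∀ n, Measurable (D n))
    (hi : iIndepFun D P) (hd : ∀ n, IdentDistrib (D n) (D 0) P P) {q f δ : ℝ}
    (hq : q ∈ Set.Ioo (0 : ℝ) 1) (hf : 0 < f)
    (hF : HasDerivAt (cdf (P.map (D 0))) f (quantileOf (cdf (P.map (D 0))) q))
    (hδ : 0 < δ) (hmom : Integrable (fun ω => |D 0 ω| ^ δ) P) :
    (∀ᶠ N : ℕ in atTop, MemLp (fun ω => empiricalQuantile (fun n => D n ω) N q) 2 P) ∧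
    Tendsto (fun N : ℕ => N * variance (fun ω => empiricalQuantile (fun n => D n ω) N q) P) atTop
      (𝓝 (q * (1 - q) / f ^ 2)) := by
  obtain ⟨C, N₀, hN₀, htail⟩ := exists_scaled_empiricalQuantile_tail hm hi hd hq hf hF hδ hmom
  have hbah := fun t (ht : 0 < t) => tendsto_bahadur_remainder hm hi hd hq hf hF ht
  have hFq := cdf_quantileOf_eq hq hF.continuousAt
  set F : ℝ → ℝ := ⇑(cdf (P.map (D 0)))
  set ξ := quantileOf F q
  have hpos : ∀ N : ℕ, N₀ ≤ N → 0 < N := fun N hN => hN₀.trans_le hN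
  have hmeas : ∀ N : ℕ, N₀ ≤ N → Measurable fun ω =>
      √N * (empiricalQuantile (fun n => D n ω) N q - ξ) := fun N hN =>
    ((measurable_empiricalQuantile hm (hpos N hN) hq).sub_const ξ).const_mul _
  have hLp : ∀ N : ℕ, N₀ ≤ N → MemLp (fun ω =>
      √N * (empiricalQuantile (fun n => D n ω) N q - ξ)) 2 P := fun N hN =>
    memLp_two_of_tail (hmeas N hN) (htail N hN)
  have hfY : ∀ N : ℕ, N₀ ≤ N → ∀ t > 0, P.real {ω | t <
      |f * (√N * (empiricalQuantile (fun n => D n ω) N q - ξ))|} ≤ C * f ^ 4 / t ^ 4 := by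
    intro N hN t ht
    refine le_trans (le_of_eq ?_) ((htail N hN (t / f) (by positivity)).trans (le_of_eq ?_))
    · congr 1
      ext ω
      rw [Set.mem_ofPred_eq, Set.mem_ofPred_eq, abs_mul f, abs_of_pos hf, div_lt_iff₀ hf, mul_comm]
    · field_simp
  have hL2 := tendsto_integral_sq_of_tail (P := P)
    (W := fun N ω => f * (√N * (empiricalQuantile (fun n => D n ω) N q - ξ))
      - empiricalDeficit F (fun n => D n ω) N ξ)
    (fun N hN => ((hmeas N hN).const_mul f).sub (measurable_empiricalDeficit hm F N ξ))
    (fun N hN t ht => measureReal_abs_add_tail ht (hfY N hN)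
      fun t ht => empiricalDeficit_tail hm hi hd (hpos N hN) ξ ht)
    hbah
  have hvar := tendsto_variance_of_tendsto_integral_sub_sq (P := P)
    (fun N hN => (hLp N hN).const_mul f) (fun N _ => memLp_empiricalDeficit hm F N ξ)
    (fun N hN => variance_empiricalDeficit hm hi hd (hpos N hN) ξ) hL2
  change Tendsto _ _ (𝓝 (F ξ * (1 - F ξ))) at hvar
  rw [hFq] at hvar
  refine ⟨?_, ?_⟩
  · filter_upwards [eventually_ge_atTop N₀] with N hN
    have hN' : (0 : ℝ) < N := by exact_mod_cast hpos N hN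
    have hs : √(N : ℝ) ≠ 0 := (Real.sqrt_pos.2 hN').ne'
    have h := ((hLp N hN).const_mul (√N)⁻¹).add (memLp_const ξ)
    refine h.congr_norm (measurable_empiricalQuantile hm (hpos N hN) hq).aestronglyMeasurable
      (ae_of_all _ fun ω => ?_)
    simp only [Pi.add_apply, inv_mul_cancel_left₀ hs, sub_add_cancel]
  -- Centring at `ξ` leaves the variance unchanged, and the scale `f * √N` contributes `f ^ 2 * N`.
  · refine (hvar.div_const (f ^ 2)).congr' ?_
    filter_upwards [eventually_ge_atTop N₀] with N hN
    rw [variance_const_mul, variance_const_mul, variance_sub_const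
      (measurable_empiricalQuantile hm (hpos N hN) hq).aestronglyMeasurable,
      Real.sq_sqrt (Nat.cast_nonneg N), mul_div_cancel_left₀ _ (by positivity)]

lemma isLittleO_of_tendsto_mul {V : ℕ → ℝ} {c f : ℝ}
    (h : Tendsto (fun N : ℕ => N * V N) atTop (𝓝 (c / f ^ 2))) :
    (fun N : ℕ => V N - c / (N * f ^ 2)) =o[atTop] (fun N : ℕ => 1 / (N : ℝ)) := by
  rw [isLittleO_iff_tendsto' ?_]
  · rw [← sub_self (c / f ^ 2)]
    refine (h.sub_const (c / f ^ 2)).congr' ?_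
    filter_upwards [eventually_gt_atTop 0] with N hN
    have : (0 : ℝ) < N := by exact_mod_cast hN
    rw [mul_comm (N : ℝ) (f ^ 2), ← div_div]
    field_simp
  · filter_upwards [eventually_gt_atTop 0] with N hN h0
    have : (0 : ℝ) < N := by exact_mod_cast hN
    exact absurd h0 (by positivity)

lemma isBigO_of_tendsto_mul {V : ℕ → ℝ} {c : ℝ}
    (h : Tendsto (fun N : ℕ => N * V N) atTop (𝓝 c)) :
    V =O[atTop] (fun N : ℕ => 1 / (N : ℝ)) := by
  have h1 := (isBigO_refl (fun N : ℕ => 1 / (N : ℝ)) atTop).mul (h.isBigO_one ℝ)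
  simp only [mul_one] at h1
  refine IsBigO.congr' h1 ?_ EventuallyEq.rfl
  filter_upwards [eventually_gt_atTop 0] with N hN
  have : (0 : ℝ) < N := by exact_mod_cast hN
  field_simp

end VarianceAsymptotics

/-! ### Application to the batch distances. -/

lemma measurable_batchDist {Ω : Type*} [MeasurableSpace Ω] {T d K : ℕ} (w : Fin d → ℝ) (εc : ℝ)
    {cand : ℕ → Fin K → Ω → Fin T → Fin d → ℝ} {target : ℕ → Ω → Fin T → Fin d → ℝ}
    (hcand : ∀ i k, Measurable (cand i k)) (htarget : ∀ j, Measurable (target j))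
    (s : ℕ × Fin K × ℕ) : Measurable (batchDist w εc cand target s) := by
  have hc : ∀ t l, Measurable fun ω => cand s.1 s.2.1 ω t l := fun t l =>
    (measurable_pi_apply l).comp ((measurable_pi_apply t).comp (hcand s.1 s.2.1))
  have ht : ∀ t l, Measurable fun ω => target s.2.2 ω t l := fun t l =>
    (measurable_pi_apply l).comp ((measurable_pi_apply t).comp (htarget s.2.2))
  refine (Finset.measurable_sum _ fun t _ => Finset.measurable_sum _ fun l _ => ?_).const_mul _
  exact ((((hc t l).sub (ht t l)).pow_const 2).add_const _).sqrt.const_mul _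

theorem mainTheorem1 {Ω : Type*} [MeasurableSpace Ω] (P : Measure Ω) [IsProbabilityMeasure P]
    {T d K : ℕ} (w : Fin d → ℝ) (εc : ℝ)
    -- generated candidates and ground-truth targets
    (cand : ℕ → Fin K → Ω → Fin T → Fin d → ℝ) (target : ℕ → Ω → Fin T → Fin d → ℝ)
    (hcand : ∀ i k, Measurable (cand i k)) (htarget : ∀ j, Measurable (target j))
    -- the sampled distances, listed by their triples `(i, k, j)`
    (s : ℕ → ℕ × Fin K × ℕ) (D : ℕ → Ω → ℝ)
    (hD : ∀ n, D n = batchDist w εc cand target (s n))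
    -- they are independent with a common law, whose CDF is `F`
    (hindep : iIndepFun D P) (hident : ∀ n, IdentDistrib (D n) (D 0) P P)
    (F : ℝ → ℝ) (hF : ∀ t, F t = cdf (P.map (D 0)) t) :
    -- (i)
    (∀ᵐ ω ∂P, TendstoUniformly (fun N => empiricalCDF (fun n => D n ω) N) F atTop) ∧
    ∀ q ∈ Set.Ioo (0 : ℝ) 1, ∀ fξ : ℝ, 0 < fξ → HasDerivAt F fξ (quantileOf F q) →
      -- (ii)
      ((∃ δ : ℝ, 0 < δ ∧ Integrable (fun ω => |D 0 ω| ^ δ) P) →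
        (∀ᶠ N : ℕ in atTop, MemLp (fun ω => empiricalQuantile (fun n => D n ω) N q) 2 P) ∧
        (fun N : ℕ => variance (fun ω => empiricalQuantile (fun n => D n ω) N q) P
            - q * (1 - q) / ((N : ℝ) * fξ ^ 2)) =o[atTop] (fun N : ℕ => 1 / (N : ℝ))) ∧
      -- (iii)
      TendstoInMeasure P (fun (N : ℕ) ω => empiricalQuantile (fun n => D n ω) N q) atTop
        (fun _ => quantileOf F q) ∧
      ((∃ δ : ℝ, 0 < δ ∧ Integrable (fun ω => |D 0 ω| ^ δ) P) →
        (fun N : ℕ => variance (fun ω => empiricalQuantile (fun n => D n ω) N q) P)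
          =O[atTop] (fun N : ℕ => 1 / (N : ℝ))) := by
  have hm : ∀ n, Measurable (D n) := fun n => by
    rw [hD n]
    exact measurable_batchDist w εc hcand htarget (s n)
  obtain rfl : F = ⇑(cdf (P.map (D 0))) := funext hF
  refine ⟨ae_tendstoUniformly_empiricalCDF hm hindep hident, fun q hq f hf hder => ?_⟩
  refine ⟨fun ⟨δ, hδ, hmom⟩ => ?_, ?_, fun ⟨δ, hδ, hmom⟩ => ?_⟩
  · have h := empiricalQuantile_variance_asymptotics hm hindep hident hq hf hder hδ hmom
    exact ⟨h.1, isLittleO_of_tendsto_mul h.2⟩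
  · rw [tendstoInMeasure_iff_measureReal_norm]
    intro ε hε
    -- Passing to `ε / 2` reconciles the non-strict inequality in convergence in measure with the
    -- strict one in the tail bound.
    refine squeeze_zero (fun _ => measureReal_nonneg) (fun N => measureReal_mono fun ω hω => ?_)
      (tendsto_empiricalQuantile_tail hm hindep hident hq hf hder (half_pos hε))
    exact (half_lt_self hε).trans_le hω
  · exact isBigO_of_tendsto_mul
      (empiricalQuantile_variance_asymptotics hm hindep hident hq hf hder hδ hmom).2
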